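/- Let $R$ be an irreducible reduced crystallographic root system with a fixed set $\Delta$ of simple roots, positive roots $R^+$, Weyl group $W$, simple reflections $s_\alpha$ ($\alpha\in\Delta$) and Coxeter length $\ell$. For roots, write $\alpha\le\beta$ if $\beta-\alpha$ is a non-negative integer combination of simple roots. A simple root $\gamma$ is cominuscule if it appears with coefficient $1$ in the highest root. Given a cominuscule simple root $\gamma$, let $X$ denote the corresponding cominuscule flag variety and let $\mathcal P_X=\{\alpha\in R:\alpha\ge\gamma\}$, partially ordered by $\le$, with each element labeled long or short according to the length of the root (a root is long if no root of $R$ is strictly longer). Let $W_I$ be the subgroup generated by the $s_\alpha$ with $\alpha\in\Delta\setminus\{\gamma\}$, and let $W^I$ be the set of minimal length representatives of the cosets in $W/W_I$. For a lower order ideal $\lambda\subseteq\mathcal P_X$, let $w_\lambda$ be the unique element of $W^I$ with inversion set $\{\alpha\in R^+: w_\lambda.\alpha<0\}=\lambda$. Let $\Delta_X^\lambda=\{\alpha\in\Delta: s_\alpha\le w_\lambda \text{ in Bruhat order}\}$, and let $\mathcal D_X^\lambda$ be the full subgraph, spanned by $\Delta_X^\lambda$, of the Dynkin diagram $\mathcal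 D_X$ of $R$ (with its multiple edges and arrows). For $\alpha\in\mathcal P_X$ let $\delta(\alpha)=-w_{\lambda_\alpha}.\alpha$, where $\lambda_\alpha=\{\beta\in\mathcal P_X:\beta\le\alpha\}$; this is a simple root. A reduced decomposition of $w\in W$ is a word $(\alpha_1,\dots,\alpha_k)$ in $\Delta$ with $s_{\alpha_1}\cdots s_{\alpha_k}=w$ and $k=\ell(w)$. **Proposition.** Let $X$ and $Y$ be the cominuscule flag varieties given by two such pairs (root system with simple roots, cominuscule simple root), and let $\lambda\subseteq\mathcal P_X$ and $\mu\subseteq\mathcal P_Y$ be lower order ideals. Let $f:\lambda\to\mu$ be an isomorphism of labeled posets, i.e. an order isomorphism such that $\alpha$ is long if and only if $f(\alpha)$ is long. Then $f$ induces an isomorphism of Dynkin diagrams $\psi:\mathcal D_X^\lambda\to\mathcal D_Y^\mu$, i.e. a bijection $\Delta_X^\lambda\to\Delta_Y^\mu$ preserving the number of edges between any two vertices and the arrows on multiple edges, such that $\delta(\alpha)\in\Delta_X^\lambda$ and $\psi(\delta(\alpha))=\delta(f(\alpha))$ for all $\alpha\in\lambda$. Moreover, $\psi$ identifies the reduced decompositions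 of $w_\lambda$ and $w_\mu$: all letters of reduced decompositions of $w_\lambda$ lie in $\Delta_X^\lambda$, all letters of reduced decompositions of $w_\mu$ lie in $\Delta_Y^\mu$, and a word $(\alpha_1,\dots,\alpha_k)$ in $\Delta_X^\lambda$ is a reduced decomposition of $w_\lambda$ if and only if $(\psi(\alpha_1),\dots,\psi(\alpha_k))$ is a reduced decomposition of $w_\mu$. -/

import Mathlib

noncomputable section

namespace Cominuscule

/-! ### Dynkin diagrams -/

/-- A diagram on a vertex set `V`: any two vertices are joined by a number of edges, and such a
(multiple) edge may carry an arrow. -/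
structure Diagram (V : Type*) where
  /-- the number of edges joining two vertices -/
  edges : V → V → ℕ
  /-- `arrow v w`: there is an arrow pointing from `v` to `w` -/
  arrow : V → V → Prop

/-- The full subdiagram spanned by a set of vertices. -/
def Diagram.induce {V : Type*} (D : Diagram V) (s : Set V) : Diagram s where
  edges v w := D.edges v w
  arrow v w := D.arrow v w

/-- Isomorphisms of diagrams: bijections on vertices that preserve the number of edges
and the arrows. -/
structure Diagram.Iso {V W : Type*} (D : Diagram V) (E : Diagram W) extends V ≃ W where
  edges_eq : ∀ v w, E.edges (toEquiv v) (toEquiv w) = D.edges v w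
  arrow_iff : ∀ v w, E.arrow (toEquiv v) (toEquiv w) ↔ D.arrow v w

variable {ι M N : Type*} [AddCommGroup M] [Module ℝ M] [AddCommGroup N] [Module ℝ N]
  {P : RootPairing ι ℝ M N}

/-- The squared length `(α, α)` of a root, for the canonical Weyl-invariant inner product. -/
def sqLength [Fintype ι] (P : RootPairing ι ℝ M N) (i : ι) : ℝ :=
  P.RootForm (P.root i) (P.root i)

/-- A root is long if no root is strictly longer (so all roots are long in the simply laced
types). -/
def IsLong [Fintype ι] (P : RootPairing ι ℝ M N) (i : ι) : Prop :=
  ∀ j, sqLength P j ≤ sqLength P i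

open Classical in
/-- The Dynkin diagram: the vertices are the simple roots, distinct simple roots `α`, `β` are
joined by `⟨α, β^∨⟩ ⟨β, α^∨⟩` edges, and a multiple edge carries an arrow from the longer to the
shorter root. -/
def dynkinDiagram [Fintype ι] [P.IsCrystallographic] (b : P.Base) : Diagram b.support where
  edges s t := if s = t then 0 else (P.coxeterWeightIn ℤ s t).toNat
  arrow s t := s ≠ t ∧ 1 < P.coxeterWeightIn ℤ s t ∧ sqLength P t < sqLength P s

/-! ### The partial order on roots -/

/-- The order on roots: `α ≤ β` if `β - α` is a non-negative sum of simple roots. -/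
def RootLE (b : P.Base) (i j : ι) : Prop :=
  P.root j - P.root i ∈ AddSubmonoid.closure (P.root '' b.support)

lemma RootLE.refl (b : P.Base) (i : ι) : RootLE b i i := by
  simp [RootLE]

lemma RootLE.trans {b : P.Base} {i j k : ι} (h : RootLE b i j) (h' : RootLE b j k) :
    RootLE b i k := by
  have := add_mem h' h
  rwa [sub_add_sub_cancel] at this

lemma RootLE.antisymm {b : P.Base} {i j : ι} (h : RootLE b i j) (h' : RootLE b j i) : i = j := by
  have key : ∀ x ∈ AddSubmonoid.closure (P.root '' (b.support : Set ι)),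
      ∃ c : b.support → ℕ, x = ∑ s, (c s : ℝ) • P.root s := by
    intro x hx
    induction hx using AddSubmonoid.closure_induction with
    | mem x hx =>
      classical
      obtain ⟨s, hs, rfl⟩ := hx
      refine ⟨Pi.single ⟨s, hs⟩ 1, ?_⟩
      rw [Finset.sum_eq_single ⟨s, hs⟩]
      · simp
      · intro t _ ht
        simp [ht]
      · simp
    | zero => exact ⟨0, by simp⟩
    | add x y _ _ hx hy =>
      obtain ⟨c, rfl⟩ := hx
      obtain ⟨d, rfl⟩ := hy
      exact ⟨c + d, by simp [add_smul, Finset.sum_add_distrib]⟩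
  obtain ⟨c, hc⟩ := key _ h
  obtain ⟨d, hd⟩ := key _ h'
  have h0 : ∑ s : b.support, ((c s : ℝ) + d s) • P.root s = 0 := by
    simp only [add_smul, Finset.sum_add_distrib]
    rw [← hc, ← hd]
    abel
  have hli : LinearIndependent ℝ (fun s : b.support ↦ P.root s) := b.linearIndepOn_root
  have hz := Fintype.linearIndependent_iff.mp hli _ h0
  have hcz : ∀ s, (c s : ℝ) = 0 := fun s ↦ by
    have h1 : (0 : ℝ) ≤ c s := Nat.cast_nonneg _
    have h2 : (0 : ℝ) ≤ d s := Nat.cast_nonneg _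
    linarith [hz s]
  have : P.root j - P.root i = 0 := by simp [hc, hcz]
  exact (P.root.injective (sub_eq_zero.mp this)).symm

/-- The simple root `γ` is cominuscule: it appears with coefficient `1` in the highest root. -/
def IsCominuscule (b : P.Base) (γ : b.support) : Prop :=
  ∃ θ : ι, (∀ i, RootLE b i θ) ∧ b.toWeightBasisInt.repr (P.rootSpanMem ℤ θ) γ = 1

/-- The poset of roots `α ≥ γ`, with the usual partial order on roots. -/
def RootPoset (b : P.Base) (γ : b.support) : Type _ := {i : ι // RootLE b γ i}

/-- The root (index) underlying an element of the poset. -/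
def RootPoset.idx {b : P.Base} {γ : b.support} (α : RootPoset b γ) : ι := α.1

instance (b : P.Base) (γ : b.support) : PartialOrder (RootPoset b γ) where
  le α β := RootLE b α.idx β.idx
  le_refl α := RootLE.refl b α.idx
  le_trans _ _ _ h h' := h.trans h'
  le_antisymm _ _ h h' := Subtype.ext (h.antisymm h')

/-! ### The Weyl group -/

/-- The product `s₁ s₂ ⋯ sₗ` of simple reflections in the Weyl group. -/
def wordProd (b : P.Base) (l : List b.support) : P.weylGroup :=
  (l.map fun s ↦ RootPairing.weylGroup.ofIdx P s).prod

/-- The Coxeter length. -/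
def length (b : P.Base) (w : P.weylGroup) : ℕ :=
  sInf {n | ∃ l : List b.support, wordProd b l = w ∧ l.length = n}

/-- The reduced decompositions of `w`: the words in the simple reflections of length `ℓ(w)` with
product `w`. Simple reflections are named by their simple roots. -/
def reducedDecompositions (b : P.Base) (w : P.weylGroup) : Set (List b.support) :=
  {l | wordProd b l = w ∧ l.length = length b w}

/-- The Bruhat order, generated by `u ≤ u t` for reflections `t` with `ℓ(u) < ℓ(u t)`. -/
def BruhatLE (b : P.Base) : P.weylGroup → P.weylGroup → Prop :=
  Relation.ReflTransGen fun u v ↦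
    ∃ i : ι, v = u * RootPairing.weylGroup.ofIdx P i ∧ length b u < length b v

/-- The parabolic subgroup `W_I`, generated by all simple reflections except the one of `γ`. -/
def parabolic (b : P.Base) (γ : b.support) : Subgroup P.weylGroup :=
  Subgroup.closure {w | ∃ s : b.support, s ≠ γ ∧ w = RootPairing.weylGroup.ofIdx P s}

/-- The set `W^I` of minimal length representatives of the cosets in `W / W_I`. -/
def minCosetReps (b : P.Base) (γ : b.support) : Set P.weylGroup :=
  {w | ∀ u ∈ parabolic b γ, length b w ≤ length b (w * u)}

/-- The inversion set `{α > 0 : w.α < 0}`; a root is negative if and only if it is not positive. -/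
def inversionSet (b : P.Base) (w : P.weylGroup) : Set ι :=
  {i | b.IsPos i ∧ ¬ b.IsPos (P.weylGroupToPerm w i)}

/-- The element `w_λ`: the (unique) element of `W^I` whose inversion set is the lower order
ideal `λ`. -/
def idealElt {b : P.Base} {γ : b.support} (lam : LowerSet (RootPoset b γ)) : P.weylGroup :=
  Classical.epsilon fun w ↦
    w ∈ minCosetReps b γ ∧ inversionSet b w = RootPoset.idx '' (lam : Set (RootPoset b γ))

/-- The map `δ(α) = -w.α`, where `w` is the element of `W^I` that belongs to the principal lower
order ideal generated by `α`. (`P.reflectionPerm i i` is the index of the negative of the root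
with index `i`.) -/
def delta {b : P.Base} {γ : b.support} (α : RootPoset b γ) : ι :=
  let i := P.weylGroupToPerm (idealElt (LowerSet.Iic α)) α.idx
  P.reflectionPerm i i

/-- The simple roots `s` in the support of `λ`, that is, with simple reflection `≤ w_λ` in Bruhat
order. -/
def supp {b : P.Base} {γ : b.support} (lam : LowerSet (RootPoset b γ)) : Set b.support :=
  {s | BruhatLE b (RootPairing.weylGroup.ofIdx P s) (idealElt lam)}

/-- The full subdiagram of the Dynkin diagram spanned by the support of `λ`. -/
def subdiagram [Fintype ι] [P.IsCrystallographic] {b : P.Base} {γ : b.support}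
    (lam : LowerSet (RootPoset b γ)) : Diagram (supp lam) :=
  (dynkinDiagram b).induce (supp lam)

end Cominuscule

end

/-!
The elements of the poset `𝒫_X` are the roots in which `γ` has coefficient `1`. Adding a minimal
element `β` of the complement to an ideal `ν` multiplies `w_ν` by the reflection in a simple root,
the *label* `δ(β) = w_ν.β`, which only depends on `β`. Hence the reduced decompositions of `w_λ`
are exactly the linear extensions of `λ`, read from the largest element down, with each element
replaced by its label (`mem_reducedDecompositions_iff`), and the support of `λ` consists of the
labels of its elements (`mem_supp_iff`). Everything therefore follows once it is known that `f`
preserves the Cartan integers between labels (`IsLabeledIso.preservesPairing`): equality of labels,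
edges and arrows can all be read off from them.

This is proved without the classification, by induction on the ideal. Let `λ = ν ∪ {β}`.

* If the label of `β` does not occur in `ν`, then the coefficient of `γ` in `w_ν⁻¹.δ(β) = β` shows
  that `δ(β)` is orthogonal to all labels in `ν` except for one, which it pairs to `-1`
  (`exists_of_label_notMem`). The element with this label is the only one that `β` covers, and the
  remaining Cartan integer is `-1` or `-2`, depending on whether the lengths are equal. So the order
  and the lengths determine all Cartan integers.
* If `δ(β) = δ(y)` for some `y ∈ ν`, then `w_μ⁻¹.δ(f(y))`, where `μ = f(ν)`, is again a root with
  `γ`-coefficient `1`, because this coefficient can be computed from Cartan integers between labels.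
  It is an element of `𝒫_Y` that can be added to `μ`, and it has the same length as `f(β)` and the
  same elements below it, since the order is generated by pairs of elements with non-orthogonal
  labels (`lt_iff_exists_pairingIn_label`). By `eq_of_twins` it is equal to `f(β)`. So `f(β)` has
  the label of `f(y)`.

The facts `eq_of_twins` is derived from concern the invariant form: the elements below two such
"twins" are all of the same length and make the same angle with them, and then the squared length of
a certain sum of labels would have to be a half-integer in suitable units.
-/

set_option linter.unusedSectionVars false

noncomputable section

namespace Cominuscule

open RootPairing

/-! ### The action of the Weyl group on roots and the invariant form -/

section Roots

variable {ι M N : Type*} [AddCommGroup M] [Module ℝ M] [AddCommGroup N] [Module ℝ N]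
  {P : RootPairing ι ℝ M N}

/-- The action of the Weyl group on the indices of the roots. -/
def act (w : P.weylGroup) (i : ι) : ι := P.weylGroupToPerm w i

lemma root_act (w : P.weylGroup) (i : ι) : P.root (act w i) = w • P.root i :=
  (weylGroup_apply_root P w i).symm

@[simp] lemma act_one (i : ι) : act (1 : P.weylGroup) i = i := by simp [act]

lemma act_mul (v w : P.weylGroup) (i : ι) : act (v * w) i = act v (act w i) := by
  simp only [act, map_mul, Equiv.Perm.mul_apply]

@[simp] lemma act_inv_act (w : P.weylGroup) (i : ι) : act w⁻¹ (act w i) = i := by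
  rw [← act_mul]; simp

@[simp] lemma act_act_inv (w : P.weylGroup) (i : ι) : act w (act w⁻¹ i) = i := by
  rw [← act_mul]; simp

lemma act_injective (w : P.weylGroup) : Function.Injective (act w) :=
  (P.weylGroupToPerm w).injective

lemma smul_ofIdx (i : ι) (m : M) : weylGroup.ofIdx P i • m = P.reflection i m := rfl

lemma act_ofIdx (i j : ι) : act (weylGroup.ofIdx P i) j = P.reflectionPerm i j := rfl

/-- The index of the negative of a root. -/
def neg (P : RootPairing ι ℝ M N) (i : ι) : ι := P.reflectionPerm i i

@[simp] lemma root_neg (i : ι) : P.root (neg P i) = -P.root i := by simp [neg]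

@[simp] lemma neg_neg' (i : ι) : neg P (neg P i) = i := by
  apply P.root.injective; simp

lemma act_neg (w : P.weylGroup) (i : ι) : act w (neg P i) = neg P (act w i) := by
  apply P.root.injective; simp [root_act]

@[simp] lemma act_ofIdx_self (i : ι) : act (weylGroup.ofIdx P i) i = neg P i := rfl

@[simp] lemma ofIdx_mul_self (i : ι) : weylGroup.ofIdx P i * weylGroup.ofIdx P i = 1 := by
  rw [mul_eq_one_iff_eq_inv]
  exact Subtype.ext (Equiv.reflection_inv P i).symm

@[simp] lemma ofIdx_inv (i : ι) : (weylGroup.ofIdx P i)⁻¹ = weylGroup.ofIdx P i :=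
  inv_eq_of_mul_eq_one_left (ofIdx_mul_self i)

lemma weylGroup_ext {v w : P.weylGroup} (h : ∀ m : M, v • m = w • m) : v = w := by
  apply Subtype.ext
  apply Equiv.weightHom_injective
  ext m
  exact h m

section Form

variable [Fintype ι]

lemma form_smul_smul (w : P.weylGroup) (x y : M) :
    P.RootForm (w • x) (w • y) = P.RootForm x y := by
  exact InvariantForm.apply_weylGroup_smul P (B := (P.posRootForm ℝ).toInvariantForm) w x y

lemma form_comm (x y : M) : P.RootForm x y = P.RootForm y x := by
  simpa using P.rootForm_symmetric.eq x y

lemma form_root_pos (i : ι) : 0 < P.RootForm (P.root i) (P.root i) :=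
  P.rootForm_pos_of_ne_zero (Submodule.subset_span ⟨i, rfl⟩) (P.ne_zero i)

lemma two_mul_form_root (x : M) (i : ι) :
    2 * P.RootForm x (P.root i) = P.coroot' i x * P.RootForm (P.root i) (P.root i) := by
  have h := P.rootForm_reflection_reflection_apply i x (P.root i)
  rw [reflection_apply_self, reflection_apply] at h
  simp only [map_sub, map_neg, map_smul, LinearMap.sub_apply, LinearMap.smul_apply,
    smul_eq_mul] at h
  linarith

lemma two_mul_form_root_root [P.IsCrystallographic] (i j : ι) :
    2 * P.RootForm (P.root i) (P.root j) =
      (P.pairingIn ℤ i j : ℝ) * P.RootForm (P.root j) (P.root j) := by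
  rw [two_mul_form_root, root_coroot'_eq_pairing]
  congr 1
  exact (P.algebraMap_pairingIn ℤ i j).symm

lemma coroot'_act (w : P.weylGroup) (i : ι) (x : M) :
    P.coroot' (act w i) (w • x) = P.coroot' i x := by
  have h1 := two_mul_form_root (P := P) (w • x) (act w i)
  have h2 := two_mul_form_root (P := P) x i
  simp only [root_act, form_smul_smul] at h1
  exact mul_right_cancel₀ (form_root_pos i).ne' (h1.symm.trans h2)

lemma pairingIn_act [P.IsCrystallographic] (w : P.weylGroup) (i j : ι) :
    P.pairingIn ℤ (act w i) (act w j) = P.pairingIn ℤ i j := by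
  have h1 := two_mul_form_root_root (P := P) (act w i) (act w j)
  have h2 := two_mul_form_root_root (P := P) i j
  simp only [root_act, form_smul_smul] at h1
  exact_mod_cast mul_right_cancel₀ (form_root_pos j).ne' (h1.symm.trans h2)

lemma coroot'_root [P.IsCrystallographic] (i j : ι) :
    P.coroot' j (P.root i) = (P.pairingIn ℤ i j : ℝ) := by
  rw [root_coroot'_eq_pairing]
  exact (P.algebraMap_pairingIn ℤ i j).symm

/-- Conjugating a reflection. -/
lemma ofIdx_act (w : P.weylGroup) (i : ι) :
    weylGroup.ofIdx P (act w i) = w * weylGroup.ofIdx P i * w⁻¹ := by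
  apply weylGroup_ext
  intro m
  obtain ⟨x, rfl⟩ : ∃ x, m = w • x := ⟨w⁻¹ • m, by simp⟩
  rw [mul_smul, inv_smul_smul, mul_smul, smul_ofIdx, smul_ofIdx, reflection_apply,
    reflection_apply, coroot'_act, root_act, smul_sub, smul_comm w]

lemma ofIdx_neg (i : ι) : weylGroup.ofIdx P (neg P i) = weylGroup.ofIdx P i := by
  rw [← act_ofIdx_self, ofIdx_act]
  simp

lemma sqLength_act (w : P.weylGroup) (i : ι) : sqLength P (act w i) = sqLength P i := by
  simp only [sqLength, root_act, form_smul_smul]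

lemma isLong_act (w : P.weylGroup) (i : ι) : IsLong P (act w i) ↔ IsLong P i := by
  simp only [IsLong, sqLength_act]

lemma pairingIn_eq_zero_comm [P.IsCrystallographic] {i j : ι} :
    P.pairingIn ℤ i j = 0 ↔ P.pairingIn ℤ j i = 0 := by
  have h1 := two_mul_form_root_root (P := P) i j
  have h2 := two_mul_form_root_root (P := P) j i
  rw [form_comm] at h1
  have hi := form_root_pos (P := P) i
  have hj := form_root_pos (P := P) j
  constructor
  · intro h
    rw [h, h2] at h1
    simpa [hi.ne'] using h1
  · intro h
    rw [h] at h2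
    rw [h2] at h1
    simpa [hj.ne'] using h1

lemma form_eq_zero_iff [P.IsCrystallographic] {i j : ι} :
    P.RootForm (P.root i) (P.root j) = 0 ↔ P.pairingIn ℤ i j = 0 := by
  have h1 := two_mul_form_root_root (P := P) i j
  have hj := form_root_pos (P := P) j
  constructor
  · intro h
    rw [h] at h1
    simpa [hj.ne'] using h1
  · intro h
    rw [h] at h1
    simpa using h1

lemma form_root_pos_iff [P.IsCrystallographic] {i j : ι} :
    0 < P.RootForm (P.root i) (P.root j) ↔ 0 < P.pairingIn ℤ i j := by
  have h1 := two_mul_form_root_root (P := P) i j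
  have hj := form_root_pos (P := P) j
  constructor
  · intro h
    have : 0 < (P.pairingIn ℤ i j : ℝ) := pos_of_mul_pos_left (by linarith) hj.le
    exact_mod_cast this
  · intro h
    have : 0 < (P.pairingIn ℤ i j : ℝ) := by exact_mod_cast h
    have := mul_pos this hj
    linarith

lemma form_root_neg_iff [P.IsCrystallographic] {i j : ι} :
    P.RootForm (P.root i) (P.root j) < 0 ↔ P.pairingIn ℤ i j < 0 := by
  have h0 := form_eq_zero_iff (P := P) (i := i) (j := j)
  have h1 := form_root_pos_iff (P := P) (i := i) (j := j)
  constructor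
  · intro h
    rcases lt_trichotomy (P.pairingIn ℤ i j) 0 with h' | h' | h'
    · exact h'
    · linarith [h0.2 h']
    · linarith [h1.2 h']
  · intro h
    rcases lt_trichotomy (P.RootForm (P.root i) (P.root j)) 0 with h' | h' | h'
    · exact h'
    · have := h0.1 h'; omega
    · have := h1.1 h'; omega

end Form

/-! ### Coordinates with respect to the simple roots -/

variable [P.IsRootSystem]

/-- The coefficient of a simple root. -/
def coef (b : P.Base) (s : b.support) : M →ₗ[ℝ] ℝ := b.toWeightBasis.coord s

/-- The non-negative integer combinations of simple roots. -/
def cone (b : P.Base) : AddSubmonoid M := AddSubmonoid.closure (P.root '' b.support)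

variable {b : P.Base}

@[simp] lemma coef_simple_self (s : b.support) : coef b s (P.root s) = 1 := by
  simp [coef]

lemma coef_simple_of_ne {s t : b.support} (h : s ≠ t) : coef b s (P.root t) = 0 := by
  simp [coef, Finsupp.single_eq_of_ne h]

lemma coef_simple [DecidableEq b.support] (s t : b.support) :
    coef b s (P.root t) = if s = t then 1 else 0 := by
  split_ifs with h
  · subst h; simp
  · exact coef_simple_of_ne h

lemma sum_coef (x : M) : ∑ s : b.support, coef b s x • P.root s = x := by
  simpa [coef] using b.toWeightBasis.sum_repr x

lemma ext_coef {x y : M} (h : ∀ s : b.support, coef b s x = coef b s y) : x = y := by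
  rw [← sum_coef (b := b) x, ← sum_coef (b := b) y]
  simp [h]

lemma root_mem_cone (s : b.support) : P.root s ∈ cone b :=
  AddSubmonoid.subset_closure ⟨s, s.2, rfl⟩

lemma mem_cone_iff {x : M} : x ∈ cone b ↔ ∀ s : b.support, ∃ n : ℕ, coef b s x = n := by
  classical
  constructor
  · intro hx s
    induction hx using AddSubmonoid.closure_induction with
    | mem x hx =>
      obtain ⟨t, ht, rfl⟩ := hx
      refine ⟨if s = ⟨t, ht⟩ then 1 else 0, ?_⟩
      have := coef_simple s (⟨t, ht⟩ : b.support)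
      push_cast
      exact this
    | zero => exact ⟨0, by simp⟩
    | add x y _ _ hx hy =>
      obtain ⟨n, hn⟩ := hx
      obtain ⟨m, hm⟩ := hy
      exact ⟨n + m, by simp [hn, hm]⟩
  · intro h
    choose c hc using h
    rw [← sum_coef (b := b) x]
    refine AddSubmonoid.sum_mem _ fun s _ ↦ ?_
    rw [hc, Nat.cast_smul_eq_nsmul]
    exact AddSubmonoid.nsmul_mem _ (root_mem_cone s) _

lemma coef_nonneg {x : M} (hx : x ∈ cone b) (s : b.support) : 0 ≤ coef b s x := by
  obtain ⟨n, hn⟩ := mem_cone_iff.1 hx s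
  rw [hn]; positivity

lemma eq_zero_of_mem_cone {x : M} (hx : x ∈ cone b) (hx' : -x ∈ cone b) : x = 0 := by
  apply ext_coef (b := b)
  intro s
  have h1 := coef_nonneg hx s
  have h2 := coef_nonneg hx' s
  rw [map_neg] at h2
  rw [map_zero]; linarith

lemma add_ne_zero_of_mem_cone {x y : M} (hx : x ∈ cone b) (hy : y ∈ cone b) (h : y ≠ 0) :
    x + y ≠ 0 := by
  intro h'
  apply h
  apply eq_zero_of_mem_cone hy
  rwa [neg_eq_of_add_eq_zero_left h']

lemma mem_cone_or_neg (b : P.Base) (i : ι) : P.root i ∈ cone b ∨ -P.root i ∈ cone b :=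
  b.root_mem_or_neg_mem i

/-- The height, as a linear functional. -/
def ht (b : P.Base) : M →ₗ[ℝ] ℝ := ∑ s, coef b s

lemma ht_simple (s : b.support) : ht b (P.root s) = 1 := by
  classical
  simp [ht, coef_simple]

lemma ht_nonneg {x : M} (hx : x ∈ cone b) : 0 ≤ ht b x := by
  simp only [ht, LinearMap.sum_apply]
  exact Finset.sum_nonneg fun s _ ↦ coef_nonneg hx s

lemma ht_pos {x : M} (hx : x ∈ cone b) (h : x ≠ 0) : 0 < ht b x := by
  refine (ht_nonneg hx).lt_of_ne fun h0 ↦ h ?_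
  simp only [ht, LinearMap.sum_apply] at h0
  have := (Finset.sum_eq_zero_iff_of_nonneg fun s _ ↦ coef_nonneg hx s).1 h0.symm
  apply ext_coef (b := b)
  intro s
  rw [this s (Finset.mem_univ s), map_zero]

lemma ht_root (i : ι) : ht b (P.root i) = b.height i := by
  classical
  obtain ⟨f, hf, -, h⟩ := b.exists_root_eq_sum_int i
  rw [Base.height_eq_sum h]
  conv_lhs => rw [h]
  rw [map_sum, Int.cast_sum]
  refine Finset.sum_congr rfl fun j hj ↦ ?_
  rw [map_zsmul, show j = ((⟨j, hj⟩ : b.support) : ι) from rfl, ht_simple]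
  simp

lemma isPos_iff_mem_cone {i : ι} : b.IsPos i ↔ P.root i ∈ cone b := by
  rw [Base.isPos_iff]
  constructor
  · intro h
    refine (mem_cone_or_neg b i).resolve_right fun h' ↦ ?_
    have := ht_nonneg h'
    rw [map_neg, ht_root] at this
    have h2 : (0 : ℝ) < b.height i := by exact_mod_cast h
    linarith
  · intro h
    have := ht_pos h (P.ne_zero i)
    rw [ht_root] at this
    exact_mod_cast this

lemma isPos_simple (s : b.support) : b.IsPos s := Base.isPos_of_mem_support s.2

lemma isPos_neg_iff {i : ι} : b.IsPos (neg P i) ↔ ¬ b.IsPos i := Base.IsPos.neg_iff_not b i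

lemma not_isPos_neg_iff {i : ι} : ¬ b.IsPos (neg P i) ↔ b.IsPos i := by
  rw [isPos_neg_iff, not_not]

lemma exists_int_coef (s : b.support) (i : ι) : ∃ n : ℤ, coef b s (P.root i) = n := by
  rcases mem_cone_or_neg b i with h | h
  · obtain ⟨n, hn⟩ := mem_cone_iff.1 h s
    exact ⟨n, by simp [hn]⟩
  · obtain ⟨n, hn⟩ := mem_cone_iff.1 h s
    exact ⟨-n, by rw [map_neg] at hn; push_cast; linarith⟩

lemma form_pos [Fintype ι] {x : M} (h : x ≠ 0) : 0 < P.RootForm x x :=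
  P.rootForm_pos_of_ne_zero (by simp) h

/-- A simple reflection only changes the coefficient of its own simple root. -/
lemma coef_ofIdx_smul {s t : b.support} (h : s ≠ t) (x : M) :
    coef b s (weylGroup.ofIdx P t • x) = coef b s x := by
  rw [smul_ofIdx, reflection_apply, map_sub, map_smul, coef_simple_of_ne h]
  simp

lemma rootLE_iff {i j : ι} : RootLE b i j ↔ P.root j - P.root i ∈ cone b := Iff.rfl

variable [P.IsCrystallographic]

lemma pairingIn_simple_nonpos [Finite ι] {s t : b.support} (h : s ≠ t) :
    P.pairingIn ℤ s t ≤ 0 :=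
  b.pairingIn_le_zero_of_ne (fun h' ↦ h (Subtype.ext h')) s.2 t.2

lemma pairingIn_simple_eq_two_iff [Finite ι] {s t : b.support} :
    P.pairingIn ℤ s t = 2 ↔ s = t := by
  constructor
  · intro h
    by_contra h'
    have := pairingIn_simple_nonpos h'
    omega
  · rintro rfl
    simp

/-- A simple reflection permutes the positive roots other than its own simple root. -/
lemma isPos_act_ofIdx [Finite ι] [P.IsReduced] {i : ι} {s : b.support} (hi : b.IsPos i)
    (h : i ≠ s) : b.IsPos (act (weylGroup.ofIdx P s) i) :=
  hi.reflectionPerm s.2 h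

end Roots

/-! ### Coxeter length, the exchange property and the Bruhat order -/

section Length

variable {ι M N : Type*} [AddCommGroup M] [Module ℝ M] [AddCommGroup N] [Module ℝ N]
  {P : RootPairing ι ℝ M N}
variable [Fintype ι] [P.IsRootSystem] [P.IsCrystallographic] [P.IsReduced] {b : P.Base}

lemma mem_inversionSet {w : P.weylGroup} {i : ι} :
    i ∈ inversionSet b w ↔ b.IsPos i ∧ ¬ b.IsPos (act w i) := Iff.rfl

lemma isPos_act_ofIdx_iff {j : ι} {s : b.support} (h : j ≠ s) (h' : j ≠ neg P s) :
    b.IsPos (act (weylGroup.ofIdx P s) j) ↔ b.IsPos j := by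
  refine ⟨fun hp ↦ ?_, fun hp ↦ isPos_act_ofIdx hp h⟩
  by_contra hn
  rw [← isPos_neg_iff] at hn
  have := isPos_act_ofIdx (s := s) hn (fun h0 ↦ h' (by rw [← h0, neg_neg']))
  rw [act_neg, isPos_neg_iff] at this
  exact this hp

lemma inversionSet_ofIdx_mul {w : P.weylGroup} {s : b.support} (h : b.IsPos (act w⁻¹ s)) :
    inversionSet b (weylGroup.ofIdx P s * w) = insert (act w⁻¹ s) (inversionSet b w) := by
  ext i
  rw [Set.mem_insert_iff, mem_inversionSet, mem_inversionSet, act_mul]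
  by_cases hi : i = act w⁻¹ s
  · subst hi
    simp [h, not_isPos_neg_iff, isPos_simple]
  · simp only [hi, false_or]
    refine and_congr_right fun hp ↦ not_congr (isPos_act_ofIdx_iff (fun h0 ↦ hi ?_) fun h0 ↦ ?_)
    · rw [← h0, act_inv_act]
    · rw [← act_inv_act w i, h0, act_neg, isPos_neg_iff] at hp
      exact hp h

lemma act_inv_notMem_inversionSet (w : P.weylGroup) (s : b.support) :
    act w⁻¹ s ∉ inversionSet b w := by
  simp [mem_inversionSet, isPos_simple]

@[simp] lemma wordProd_nil : wordProd b [] = 1 := rfl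

@[simp] lemma wordProd_cons (s : b.support) (l : List b.support) :
    wordProd b (s :: l) = weylGroup.ofIdx P s * wordProd b l := by
  simp [wordProd]

@[simp] lemma wordProd_append (l l' : List b.support) :
    wordProd b (l ++ l') = wordProd b l * wordProd b l' := by
  simp [wordProd]

lemma wordProd_reverse (l : List b.support) : wordProd b l.reverse = (wordProd b l)⁻¹ := by
  induction l with
  | nil => simp
  | cons s l ih => simp [ih]

/-- The Weyl group is generated by the simple reflections. -/
lemma exists_word (b : P.Base) (w : P.weylGroup) : ∃ l, wordProd b l = w := by
  have key (i : ι) : ∃ l, wordProd b l = weylGroup.ofIdx P i := by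
    induction i using b.induction_reflect with
    | h₀ i h =>
      obtain ⟨l, hl⟩ := h
      exact ⟨l, hl.trans (ofIdx_neg i).symm⟩
    | h₁ i h => exact ⟨[⟨i, h⟩], by simp⟩
    | h₂ i j h hj =>
      obtain ⟨l, hl⟩ := h
      refine ⟨⟨j, hj⟩ :: (l ++ [⟨j, hj⟩]), ?_⟩
      have := ofIdx_act (weylGroup.ofIdx P j) i
      rw [act_ofIdx] at this
      simp [hl, this, mul_assoc]
  obtain ⟨w, hw⟩ := w
  induction hw using weylGroup.induction with
  | mem i => exact key i
  | one => exact ⟨[], rfl⟩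
  | mul x y hx hy h h' =>
    obtain ⟨l, hl⟩ := h
    obtain ⟨l', hl'⟩ := h'
    exact ⟨l ++ l', by rw [wordProd_append, hl, hl']; rfl⟩

lemma exists_reduced_word (b : P.Base) (w : P.weylGroup) :
    ∃ l, wordProd b l = w ∧ l.length = length b w := by
  obtain ⟨l, hl⟩ := exists_word b w
  exact Nat.sInf_mem (s := {n | ∃ l : List b.support, wordProd b l = w ∧ l.length = n})
    ⟨_, l, hl, rfl⟩

lemma length_wordProd_le (l : List b.support) : length b (wordProd b l) ≤ l.length :=
  Nat.sInf_le ⟨l, rfl, rfl⟩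

/-- The strong exchange property. -/
lemma exists_sublist_of_not_isPos (l : List b.support) {i : ι} (hi : b.IsPos i)
    (h : ¬ b.IsPos (act (wordProd b l)⁻¹ i)) :
    ∃ l', l'.Sublist l ∧ l'.length + 1 = l.length ∧
      wordProd b l' = weylGroup.ofIdx P i * wordProd b l := by
  induction l generalizing i with
  | nil => simp [hi] at h
  | cons s l ih =>
    by_cases his : i = s
    · subst his
      exact ⟨l, by simp, by simp, by simp [← mul_assoc]⟩
    · rw [wordProd_cons, mul_inv_rev, ofIdx_inv, act_mul] at h
      obtain ⟨l', h1, h2, h3⟩ := ih (isPos_act_ofIdx hi his) h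
      refine ⟨s :: l', by simpa using h1, by simpa using h2, ?_⟩
      rw [wordProd_cons, wordProd_cons, h3, ofIdx_act]
      simp [← mul_assoc]

/-- In a reduced word, the first letter creates a new inversion. -/
lemma isPos_of_reduced_cons {s : b.support} {l : List b.support}
    (h : (s :: l).length = length b (wordProd b (s :: l))) :
    b.IsPos (act (wordProd b l)⁻¹ s) := by
  by_contra hn
  obtain ⟨l', -, h2, h3⟩ := exists_sublist_of_not_isPos l (isPos_simple s) hn
  have := length_wordProd_le l'
  rw [h3, ← wordProd_cons, ← h] at this
  simp at this
  omega

lemma reduced_tail {s : b.support} {l : List b.support}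
    (h : (s :: l).length = length b (wordProd b (s :: l))) :
    l.length = length b (wordProd b l) := by
  refine le_antisymm ?_ (length_wordProd_le l)
  obtain ⟨l', h1, h2⟩ := exists_reduced_word b (wordProd b l)
  have := length_wordProd_le (s :: l')
  rw [wordProd_cons, h1, ← wordProd_cons, ← h] at this
  simp at this
  omega

lemma ncard_inversionSet_of_reduced (l : List b.support)
    (h : l.length = length b (wordProd b l)) :
    (inversionSet b (wordProd b l)).ncard = l.length := by
  induction l with
  | nil =>
    have : inversionSet b (1 : P.weylGroup) = ∅ := by
      ext i; simp [mem_inversionSet]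
    simp [this]
  | cons s l ih =>
    rw [wordProd_cons, inversionSet_ofIdx_mul (isPos_of_reduced_cons h),
      Set.ncard_insert_of_notMem (act_inv_notMem_inversionSet _ _) (Set.toFinite _),
      ih (reduced_tail h)]
    simp

/-- The Coxeter length is the number of inversions. -/
lemma length_eq_ncard (w : P.weylGroup) : length b w = (inversionSet b w).ncard := by
  obtain ⟨l, rfl, h⟩ := exists_reduced_word b w
  rw [ncard_inversionSet_of_reduced l h, h]

lemma eq_one_of_inversionSet_eq_empty {w : P.weylGroup} (h : inversionSet b w = ∅) : w = 1 := by
  obtain ⟨l, h1, h2⟩ := exists_reduced_word b w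
  rw [length_eq_ncard, h, Set.ncard_empty, List.length_eq_zero_iff] at h2
  rw [← h1, h2, wordProd_nil]

/-- A Weyl group element is determined by its inversions. -/
lemma eq_of_inversionSet_eq {v w : P.weylGroup} (h : inversionSet b v = inversionSet b w) :
    v = w := by
  have key (i : ι) (hi : b.IsPos i) : b.IsPos (act v i) ↔ b.IsPos (act w i) := by
    have := Set.ext_iff.1 h i
    rw [mem_inversionSet, mem_inversionSet] at this
    tauto
  have key' (i : ι) : b.IsPos (act v i) ↔ b.IsPos (act w i) := by
    by_cases hi : b.IsPos i
    · exact key i hi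
    · rw [← isPos_neg_iff] at hi
      have := key _ hi
      rw [act_neg, act_neg, isPos_neg_iff, isPos_neg_iff] at this
      tauto
  rw [← mul_inv_eq_one]
  apply eq_one_of_inversionSet_eq_empty (b := b)
  ext i
  simp only [mem_inversionSet, act_mul, key', act_act_inv]
  simp

/-- Words in a set of letters are closed under going down in the Bruhat order. -/
lemma exists_word_of_bruhatLE {J : Set b.support} {u v : P.weylGroup} (h : BruhatLE b u v)
    (hv : ∃ l, wordProd b l = v ∧ ∀ s ∈ l, s ∈ J) : ∃ l, wordProd b l = u ∧ ∀ s ∈ l, s ∈ J := by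
  induction h using Relation.ReflTransGen.head_induction_on with
  | refl => exact hv
  | head h _ ih =>
    rename_i x y _
    obtain ⟨l, hl, hJ⟩ := ih
    obtain ⟨i, rfl, hlt⟩ := h
    obtain ⟨j, hj, hij⟩ : ∃ j, b.IsPos j ∧ weylGroup.ofIdx P j = weylGroup.ofIdx P i := by
      by_cases hi : b.IsPos i
      · exact ⟨i, hi, rfl⟩
      · exact ⟨neg P i, isPos_neg_iff.2 hi, ofIdx_neg i⟩
    rw [← hij] at hl hlt
    by_cases hp : b.IsPos (act x j)
    · have hn : ¬ b.IsPos (act (wordProd b l.reverse)⁻¹ j) := by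
        rw [wordProd_reverse, inv_inv, hl, act_mul, act_ofIdx_self, act_neg, not_isPos_neg_iff]
        exact hp
      obtain ⟨l', h1, -, h3⟩ := exists_sublist_of_not_isPos l.reverse hj hn
      refine ⟨l'.reverse, ?_, fun s hs ↦ hJ s ?_⟩
      · rw [wordProd_reverse, h3, wordProd_reverse, hl]
        simp [← mul_assoc]
      · simpa using h1.subset (List.mem_reverse.1 hs)
    · -- the reflection would shorten `x`, contrary to the assumption
      exfalso
      obtain ⟨r, hr, hr'⟩ := exists_reduced_word b x
      have hn : ¬ b.IsPos (act (wordProd b r.reverse)⁻¹ j) := by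
        rwa [wordProd_reverse, inv_inv, hr]
      obtain ⟨l', -, h2, h3⟩ := exists_sublist_of_not_isPos r.reverse hj hn
      have := length_wordProd_le l'.reverse
      rw [wordProd_reverse, h3, wordProd_reverse, hr, mul_inv_rev, inv_inv, ofIdx_inv] at this
      simp at this h2
      omega

/-- A simple reflection below `w` in the Bruhat order occurs in every word for `w`. -/
lemma mem_of_bruhatLE {s : b.support} {l : List b.support}
    (h : BruhatLE b (weylGroup.ofIdx P s) (wordProd b l)) : s ∈ l := by
  obtain ⟨l', h1, h2⟩ := exists_word_of_bruhatLE (J := {t | t ∈ l}) h ⟨l, rfl, fun s hs ↦ hs⟩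
  by_contra hs
  have key : ∀ (r : List b.support) (x : M), (∀ t ∈ r, t ∈ l) →
      coef b s (wordProd b r • x) = coef b s x := by
    intro r
    induction r with
    | nil => simp
    | cons t r ih =>
      intro x hr
      have hst : s ≠ t := by
        rintro rfl
        exact hs (hr s (by simp))
      rw [wordProd_cons, mul_smul, coef_ofIdx_smul hst, ih x fun t ht ↦ hr t (by simp [ht])]
  have := key l' (P.root s) h2
  rw [h1, smul_ofIdx, reflection_apply_self, map_neg, coef_simple_self] at this
  norm_num at this

lemma bruhatLE_of_reduced_append_left (l l' : List b.support)
    (h : (l ++ l').length = length b (wordProd b (l ++ l'))) :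
    l'.length = length b (wordProd b l') ∧ BruhatLE b (wordProd b l') (wordProd b (l ++ l')) := by
  induction l with
  | nil => exact ⟨h, Relation.ReflTransGen.refl⟩
  | cons s l ih =>
    have ht : (l ++ l').length = length b (wordProd b (l ++ l')) := reduced_tail h
    obtain ⟨h1, h2⟩ := ih ht
    refine ⟨h1, h2.tail ⟨act (wordProd b (l ++ l'))⁻¹ s, ?_, ?_⟩⟩
    · rw [ofIdx_act]
      simp [mul_assoc]
    · rw [← ht, ← h]
      simp

lemma bruhatLE_of_reduced_append_right (l l' : List b.support)
    (h : (l ++ l').length = length b (wordProd b (l ++ l'))) :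
    BruhatLE b (wordProd b l) (wordProd b (l ++ l')) := by
  induction l' using List.reverseRecOn with
  | nil =>
    rw [List.append_nil]
    exact Relation.ReflTransGen.refl
  | append_singleton l' s ih =>
    have h' : (l ++ l').length = length b (wordProd b (l ++ l')) := by
      refine le_antisymm ?_ (length_wordProd_le _)
      obtain ⟨r, h1, h2⟩ := exists_reduced_word b (wordProd b (l ++ l'))
      have := length_wordProd_le (r ++ [s])
      rw [wordProd_append, h1, ← wordProd_append, List.append_assoc, ← h] at this
      simp only [List.length_append, List.length_singleton] at this ⊢
      omega
    refine (ih h').tail ⟨s, ?_, ?_⟩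
    · simp [mul_assoc]
    · rw [← h', ← h]
      simp

/-- The letters of a reduced word are below the word in the Bruhat order. -/
lemma bruhatLE_of_mem_reduced {s : b.support} {l : List b.support} (hs : s ∈ l)
    (h : l.length = length b (wordProd b l)) :
    BruhatLE b (weylGroup.ofIdx P s) (wordProd b l) := by
  obtain ⟨l₁, l₂, rfl⟩ := List.append_of_mem hs
  obtain ⟨h1, h2⟩ := bruhatLE_of_reduced_append_left l₁ (s :: l₂) h
  have := bruhatLE_of_reduced_append_right [s] l₂ h1
  simp only [wordProd_cons, wordProd_nil, mul_one, List.singleton_append] at this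
  rw [← wordProd_cons] at this
  exact this.trans h2

end Length

/-! ### Lower sets of finite partial orders -/

section LowerSet

variable {α : Type*} [PartialOrder α]

/-- `β` is a minimal element of the complement of the lower set `ν`. -/
def MinOver (ν : LowerSet α) (β : α) : Prop := β ∉ ν ∧ ∀ x < β, x ∈ ν

lemma minOver_Iio (β : α) : MinOver (LowerSet.Iio β) β :=
  ⟨by simp, fun x hx ↦ by simpa using hx⟩

lemma MinOver.mem_sup_Iic {ν : LowerSet α} {β : α} (h : MinOver ν β) {x : α} :
    x ∈ ν ⊔ LowerSet.Iic β ↔ x = β ∨ x ∈ ν := by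
  rw [LowerSet.mem_sup_iff, LowerSet.mem_Iic_iff]
  constructor
  · rintro (hx | hx)
    · exact .inr hx
    · exact hx.eq_or_lt.imp id (h.2 x)
  · rintro (rfl | hx)
    · exact .inr le_rfl
    · exact .inl hx

lemma MinOver.coe_sup_Iic {ν : LowerSet α} {β : α} (h : MinOver ν β) :
    ((ν ⊔ LowerSet.Iic β : LowerSet α) : Set α) = insert β (ν : Set α) := by
  ext x
  exact h.mem_sup_Iic

lemma Iio_sup_Iic (β : α) : LowerSet.Iio β ⊔ LowerSet.Iic β = LowerSet.Iic β := by
  ext x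
  simp only [LowerSet.coe_sup, LowerSet.coe_Iio, LowerSet.coe_Iic, Set.mem_union, Set.mem_Iio,
    Set.mem_Iic]
  exact ⟨fun h ↦ h.elim le_of_lt id, .inr⟩

/-- A maximal element of a lower set can be removed. -/
lemma exists_sup_Iic_eq {ν : LowerSet α} {β : α} (hβ : β ∈ ν) (hmax : ∀ x ∈ ν, ¬ β < x) :
    ∃ ν', MinOver ν' β ∧ ν' ⊔ LowerSet.Iic β = ν ∧ ∀ x, x ∈ ν' ↔ x ∈ ν ∧ x ≠ β := by
  let ν' : LowerSet α := ⟨{x | x ∈ ν ∧ x ≠ β}, fun x y hyx hx ↦ ⟨ν.lower hyx hx.1, by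
    rintro rfl
    exact hmax x hx.1 (hyx.lt_of_ne' hx.2)⟩⟩
  have hmin : MinOver ν' β := ⟨fun h ↦ h.2 rfl, fun x hx ↦ ⟨ν.lower hx.le hβ, hx.ne⟩⟩
  refine ⟨ν', hmin, ?_, fun x ↦ Iff.rfl⟩
  ext x
  rw [SetLike.mem_coe, hmin.mem_sup_Iic]
  constructor
  · rintro (rfl | h)
    exacts [hβ, h.1]
  · intro h
    by_cases hx : x = β
    exacts [.inl hx, .inr ⟨h, hx⟩]

/-- A maximal element of a finite lower set outside of another lower set. -/
lemma exists_maximal_notMem [Finite α] {ν ν₀ : LowerSet α} (h : ¬ ν ≤ ν₀) :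
    ∃ y ∈ ν, y ∉ ν₀ ∧ ∀ x ∈ ν, ¬ y < x := by
  obtain ⟨z, hz, hz'⟩ := Set.not_subset.1 h
  obtain ⟨y, hy⟩ := (Set.toFinite {y | y ∈ ν ∧ y ∉ ν₀}).exists_maximal ⟨z, hz, hz'⟩
  exact ⟨y, hy.prop.1, hy.prop.2, fun x hx hlt ↦
    hy.not_prop_of_gt hlt ⟨hx, fun hx' ↦ hy.prop.2 (ν₀.lower hlt.le hx')⟩⟩

/-- Induction over lower sets, adding one element at a time. -/
lemma lowerSet_induction [Finite α] {p : LowerSet α → Prop} (bot : p ⊥)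
    (step : ∀ ν β, MinOver ν β → p ν → p (ν ⊔ LowerSet.Iic β)) (ν : LowerSet α) : p ν := by
  induction hn : (ν : Set α).ncard generalizing ν with
  | zero =>
    rw [Set.ncard_eq_zero (Set.toFinite _)] at hn
    rwa [show ν = ⊥ from SetLike.coe_injective hn]
  | succ n ih =>
    have hne : ¬ ν ≤ ⊥ := by
      intro h
      rw [le_bot_iff] at h
      simp [h] at hn
    obtain ⟨β, hβ, -, hmax⟩ := exists_maximal_notMem hne
    obtain ⟨ν', h1, h2, -⟩ := exists_sup_Iic_eq hβ hmax
    rw [← h2] at hn ⊢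
    refine step _ _ h1 (ih _ ?_)
    rw [h1.coe_sup_Iic, Set.ncard_insert_of_notMem h1.1 (Set.toFinite _)] at hn
    omega

/-- The finite set of elements of a lower set. -/
def elts [Finite α] (ν : LowerSet α) : Finset α := (Set.toFinite (ν : Set α)).toFinset

@[simp] lemma mem_elts [Finite α] {ν : LowerSet α} {x : α} : x ∈ elts ν ↔ x ∈ ν := by
  simp [elts]

lemma MinOver.sum_elts [Finite α] {A : Type*} [AddCommMonoid A] {ν : LowerSet α} {β : α}
    (h : MinOver ν β) (g : α → A) :
    ∑ y ∈ elts (ν ⊔ LowerSet.Iic β), g y = g β + ∑ y ∈ elts ν, g y := by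
  classical
  have : elts (ν ⊔ LowerSet.Iic β) = insert β (elts ν) := by
    ext x
    rw [mem_elts, h.mem_sup_Iic, Finset.mem_insert, mem_elts]
  rw [this, Finset.sum_insert (by simpa using h.1)]

end LowerSet

/-! ### The poset of a cominuscule simple root -/

section Poset

variable {ι M N : Type*} [AddCommGroup M] [Module ℝ M] [AddCommGroup N] [Module ℝ N]
  {P : RootPairing ι ℝ M N} [Fintype ι] [P.IsRootSystem] [P.IsCrystallographic] [P.IsReduced]
  {b : P.Base} {γ : b.support}

instance : Finite (RootPoset b γ) := inferInstanceAs (Finite {i : ι // RootLE b γ i})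

lemma idx_injective : Function.Injective (RootPoset.idx : RootPoset b γ → ι) :=
  Subtype.val_injective

lemma le_iff {x y : RootPoset b γ} : x ≤ y ↔ P.root y.idx - P.root x.idx ∈ cone b := Iff.rfl

lemma sub_ne_zero_of_lt {x y : RootPoset b γ} (h : x < y) :
    P.root y.idx - P.root x.idx ≠ 0 := by
  rw [sub_ne_zero]
  exact fun h' ↦ h.ne' (idx_injective (P.root.injective h'))

lemma isPos_idx (x : RootPoset b γ) : b.IsPos x.idx := by
  rw [isPos_iff_mem_cone]
  have := (cone b).add_mem (le_iff.1 (le_refl x)) (show P.root x.idx - P.root γ ∈ cone b from x.2)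
  simpa using (cone b).add_mem this (root_mem_cone γ)

-- As a `Fact`, the hypothesis is found by instance search wherever labels occur.
variable [hγ : Fact (IsCominuscule b γ)]

lemma coef_root_le_one (i : ι) : coef b γ (P.root i) ≤ 1 := by
  obtain ⟨θ, hθ, h⟩ := hγ.out
  have h1 : coef b γ (P.root θ) = 1 := by
    have := congrArg (Submodule.subtype _) (b.toWeightBasisInt.sum_repr (P.rootSpanMem ℤ θ))
    rw [map_sum] at this
    have h2 : P.root θ = ∑ s : b.support,
        b.toWeightBasisInt.repr (P.rootSpanMem ℤ θ) s • P.root s := by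
      refine this.symm.trans (Finset.sum_congr rfl fun s _ ↦ ?_)
      rw [map_zsmul]
      simp
    rw [h2, map_sum, Finset.sum_eq_single γ]
    · rw [map_zsmul, coef_simple_self, h]
      simp
    · intro s _ hs
      rw [map_zsmul, coef_simple_of_ne hs.symm, smul_zero]
    · simp
  have := coef_nonneg (hθ i) γ
  rw [map_sub, h1] at this
  linarith

lemma neg_one_le_coef_root (i : ι) : -1 ≤ coef b γ (P.root i) := by
  have := coef_root_le_one (γ := γ) (neg P i)
  rw [root_neg, map_neg] at this
  linarith

/-- The poset of a cominuscule simple root `γ` consists of the roots in which `γ` has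
coefficient `1`. -/
lemma rootLE_iff_coef {i : ι} : RootLE b γ i ↔ coef b γ (P.root i) = 1 := by
  constructor
  · intro h
    have := coef_nonneg (b := b) h γ
    rw [map_sub, coef_simple_self] at this
    linarith [coef_root_le_one (γ := γ) i]
  · intro h
    have hi : P.root i ∈ cone b := by
      refine (mem_cone_or_neg b i).resolve_right fun h' ↦ ?_
      have := coef_nonneg h' γ
      rw [map_neg, h] at this
      norm_num at this
    rw [rootLE_iff, mem_cone_iff]
    intro s
    obtain ⟨n, hn⟩ := mem_cone_iff.1 hi s
    by_cases hs : s = γ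
    · subst hs
      exact ⟨0, by rw [map_sub, h]; simp⟩
    · exact ⟨n, by rw [map_sub, hn, coef_simple_of_ne hs]; simp⟩

lemma coef_idx (x : RootPoset b γ) : coef b γ (P.root x.idx) = 1 := rootLE_iff_coef.1 x.2

/-- The element of the poset given by a root in which `γ` has coefficient `1`. -/
def ofCoef (i : ι) (h : coef b γ (P.root i) = 1) : RootPoset b γ := ⟨i, rootLE_iff_coef.2 h⟩

@[simp] lemma idx_ofCoef (i : ι) (h : coef b γ (P.root i) = 1) : (ofCoef i h).idx = i := rfl

lemma isPos_of_coef {i : ι} (h : coef b γ (P.root i) = 1) : b.IsPos i := isPos_idx (ofCoef i h)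

/-- Reflecting one element of the poset in another one must not lead to a root in which the
coefficient of `γ` exceeds `1` in absolute value. -/
lemma pairingIn_idx_mem (x y : RootPoset b γ) :
    0 ≤ P.pairingIn ℤ x.idx y.idx ∧ P.pairingIn ℤ x.idx y.idx ≤ 2 := by
  have h : P.root (act (weylGroup.ofIdx P y.idx) x.idx) =
      P.root x.idx - (P.pairingIn ℤ x.idx y.idx : ℝ) • P.root y.idx := by
    rw [root_act, smul_ofIdx, reflection_apply, coroot'_root]
  have h1 := coef_root_le_one (γ := γ) (act (weylGroup.ofIdx P y.idx) x.idx)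
  have h2 := neg_one_le_coef_root (γ := γ) (act (weylGroup.ofIdx P y.idx) x.idx)
  rw [h, map_sub, map_smul, coef_idx, coef_idx] at h1 h2
  simp only [smul_eq_mul, mul_one] at h1 h2
  constructor
  · have : (0 : ℝ) ≤ P.pairingIn ℤ x.idx y.idx := by linarith
    exact_mod_cast this
  · have : (P.pairingIn ℤ x.idx y.idx : ℝ) ≤ 2 := by linarith
    exact_mod_cast this

lemma act_ofIdx_of_pairingIn_eq_zero {i j : ι} (h : P.pairingIn ℤ i j = 0) :
    act (weylGroup.ofIdx P j) i = i := by
  apply P.root.injective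
  rw [root_act, smul_ofIdx, reflection_apply, coroot'_root, h]
  simp

/-! ### The Weyl group elements of lower order ideals -/

/-- A root that becomes simple when all inversions below it have been made: otherwise it would be
a sum of two roots that are not inverted, one of which would be a smaller element of the poset. -/
lemma exists_act_eq_simple {ν : LowerSet (RootPoset b γ)} {w : P.weylGroup} {β : RootPoset b γ}
    (hw : inversionSet b w = RootPoset.idx '' (ν : Set (RootPoset b γ))) (hβ : MinOver ν β) :
    ∃ s : b.support, act w β.idx = s := by
  have key (i j : ι) (hi : b.IsPos (act w i)) (hj : b.IsPos (act w j))
      (hij : P.root β.idx = P.root i + P.root j) (hci : coef b γ (P.root i) = 1)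
      (hcj : coef b γ (P.root j) = 0) : False := by
    have hpj : b.IsPos j := by
      by_contra hn
      have : neg P j ∈ inversionSet b w := by
        rw [mem_inversionSet, act_neg, not_isPos_neg_iff, isPos_neg_iff]
        exact ⟨hn, hj⟩
      rw [hw] at this
      obtain ⟨x, -, hx⟩ := this
      have := coef_idx x
      rw [hx, root_neg, map_neg, hcj] at this
      norm_num at this
    have hlt : ofCoef i hci < β := by
      refine lt_of_le_of_ne ?_ fun h ↦ ?_
      · rw [le_iff, idx_ofCoef, hij, add_sub_cancel_left]
        exact isPos_iff_mem_cone.1 hpj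
      · rw [← h, idx_ofCoef] at hij
        exact P.ne_zero j (by simpa using hij)
    have : i ∈ inversionSet b w := by
      rw [hw]
      exact ⟨_, hβ.2 _ hlt, rfl⟩
    exact this.2 hi
  have hpos : b.IsPos (act w β.idx) := by
    by_contra hn
    have : β.idx ∈ inversionSet b w := ⟨isPos_idx β, hn⟩
    rw [hw, idx_injective.mem_set_image] at this
    exact hβ.1 this
  obtain ⟨j, hj, hj'⟩ := hpos.exists_mem_support_pos_pairingIn
  rw [P.zero_lt_pairingIn_iff'] at hj'
  by_cases hne : act w β.idx = j
  · exact ⟨⟨j, hj⟩, hne⟩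
  exfalso
  obtain ⟨k, hk⟩ := P.root_sub_root_mem_of_pairingIn_pos hj' hne
  have hkp : b.IsPos k := hpos.sub hj hk
  have hsum : P.root β.idx = P.root (act w⁻¹ j) + P.root (act w⁻¹ k) := by
    rw [root_act, root_act, ← smul_add, hk, add_sub_cancel, ← root_act, act_inv_act]
  have hc := coef_idx β
  rw [hsum, map_add] at hc
  obtain ⟨m, hm⟩ := exists_int_coef γ (act w⁻¹ j)
  obtain ⟨n, hn⟩ := exists_int_coef γ (act w⁻¹ k)
  have h1 := coef_root_le_one (γ := γ) (act w⁻¹ j)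
  have h2 := coef_root_le_one (γ := γ) (act w⁻¹ k)
  rw [hm, hn] at hc
  rw [hm] at h1
  rw [hn] at h2
  have hjp : b.IsPos (act w (act w⁻¹ j)) := by
    rw [act_act_inv]
    exact Base.isPos_of_mem_support hj
  have hkp' : b.IsPos (act w (act w⁻¹ k)) := by rwa [act_act_inv]
  norm_cast at hc h1 h2
  obtain ⟨rfl, rfl⟩ | ⟨rfl, rfl⟩ : m = 1 ∧ n = 0 ∨ m = 0 ∧ n = 1 := by omega
  · exact key _ _ hjp hkp' hsum (by simpa using hm) (by simpa using hn)
  · exact key _ _ hkp' hjp (by rw [hsum, add_comm]) (by simpa using hn) (by simpa using hm)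

lemma inversionSet_ofIdx_mul_of_act {ν : LowerSet (RootPoset b γ)} {w : P.weylGroup}
    {β : RootPoset b γ} {s : b.support}
    (hw : inversionSet b w = RootPoset.idx '' (ν : Set (RootPoset b γ))) (hs : act w β.idx = s) :
    inversionSet b (weylGroup.ofIdx P s * w) =
      RootPoset.idx '' (insert β (ν : Set (RootPoset b γ))) := by
  have h : act w⁻¹ s = β.idx := by rw [← hs, act_inv_act]
  rw [inversionSet_ofIdx_mul (by rw [h]; exact isPos_idx β), h, hw, Set.image_insert_eq]

lemma exists_inversionSet_eq (ν : LowerSet (RootPoset b γ)) :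
    ∃ w : P.weylGroup, inversionSet b w = RootPoset.idx '' (ν : Set (RootPoset b γ)) := by
  induction ν using lowerSet_induction with
  | bot => exact ⟨1, by ext i; simp [mem_inversionSet]⟩
  | step ν β h ih =>
    obtain ⟨w, hw⟩ := ih
    obtain ⟨s, hs⟩ := exists_act_eq_simple hw h
    exact ⟨_, by rw [inversionSet_ofIdx_mul_of_act hw hs, h.coe_sup_Iic]⟩

/-- A set of inversions in the poset is automatically a lower order ideal. -/
lemma exists_lowerSet_of_inversionSet {w : P.weylGroup}
    (h : ∀ i ∈ inversionSet b w, coef b γ (P.root i) = 1) :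
    ∃ ν : LowerSet (RootPoset b γ), inversionSet b w = RootPoset.idx '' (ν : Set (RootPoset b γ))
      := by
  refine ⟨⟨{x | x.idx ∈ inversionSet b w}, fun x y hyx hx ↦ ⟨isPos_idx y, fun hy ↦ hx.2 ?_⟩⟩, ?_⟩
  · have hsum : P.root x.idx = P.root y.idx + (P.root x.idx - P.root y.idx) := by abel
    rw [isPos_iff_mem_cone] at hy ⊢
    change P.root (act w x.idx) ∈ cone b
    change P.root (act w y.idx) ∈ cone b at hy
    rw [root_act, hsum, smul_add, ← root_act]
    refine (cone b).add_mem hy ?_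
    rw [← sum_coef (b := b) (P.root x.idx - P.root y.idx), Finset.smul_sum]
    refine AddSubmonoid.sum_mem _ fun s _ ↦ ?_
    obtain ⟨n, hn⟩ := mem_cone_iff.1 hyx s
    change coef b s (P.root x.idx - P.root y.idx) = n at hn
    rw [hn, smul_comm, Nat.cast_smul_eq_nsmul]
    by_cases hs : s = γ
    · subst hs
      rw [map_sub, coef_idx, coef_idx, sub_self] at hn
      have : n = 0 := by exact_mod_cast hn.symm
      simp [this]
    · refine AddSubmonoid.nsmul_mem _ ?_ _
      rw [← root_act, ← isPos_iff_mem_cone]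
      by_contra hsp
      have := h s ⟨isPos_simple s, hsp⟩
      rw [coef_simple_of_ne (Ne.symm hs)] at this
      norm_num at this
  · ext i
    constructor
    · intro hi
      exact ⟨ofCoef i (h i hi), hi, rfl⟩
    · rintro ⟨x, hx, rfl⟩
      exact hx

lemma coef_parabolic {u : P.weylGroup} (hu : u ∈ parabolic b γ) (x : M) :
    coef b γ (u • x) = coef b γ x := by
  induction hu using Subgroup.closure_induction generalizing x with
  | mem u hu =>
    obtain ⟨s, hs, rfl⟩ := hu
    exact coef_ofIdx_smul hs.symm x
  | one => simp
  | mul u v _ _ hu hv => rw [mul_smul, hu, hv]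
  | inv u _ hu => rw [← hu (u⁻¹ • x), smul_inv_smul]

/-- An element whose inversions all lie in the poset has minimal length in its coset: the
group `W_I` preserves the coefficient of `γ`, and hence sends roots of the poset to positive
roots. -/
lemma mem_minCosetReps {w : P.weylGroup} (h : ∀ i ∈ inversionSet b w, coef b γ (P.root i) = 1) :
    w ∈ minCosetReps b γ := by
  intro u hu
  rw [length_eq_ncard, length_eq_ncard]
  refine Set.ncard_le_ncard_of_injOn (act u⁻¹) (fun i hi ↦ ?_) (act_injective _).injOn
    (Set.toFinite _)
  rw [mem_inversionSet, act_mul, act_act_inv]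
  refine ⟨isPos_of_coef (γ := γ) ?_, hi.2⟩
  rw [root_act, coef_parabolic (inv_mem hu), h i hi]

lemma inversionSet_idealElt (ν : LowerSet (RootPoset b γ)) :
    inversionSet b (idealElt ν) = RootPoset.idx '' (ν : Set (RootPoset b γ)) := by
  refine (Classical.epsilon_spec (p := fun w ↦ w ∈ minCosetReps b γ ∧
    inversionSet b w = RootPoset.idx '' (ν : Set (RootPoset b γ))) ?_).2
  obtain ⟨w, hw⟩ := exists_inversionSet_eq ν
  refine ⟨w, mem_minCosetReps fun i hi ↦ ?_, hw⟩
  rw [hw] at hi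
  obtain ⟨x, -, rfl⟩ := hi
  exact coef_idx x

lemma idealElt_eq {ν : LowerSet (RootPoset b γ)} {w : P.weylGroup}
    (hw : inversionSet b w = RootPoset.idx '' (ν : Set (RootPoset b γ))) : idealElt ν = w :=
  eq_of_inversionSet_eq (b := b) (by rw [inversionSet_idealElt, hw])

lemma length_idealElt (ν : LowerSet (RootPoset b γ)) :
    length b (idealElt ν) = (ν : Set (RootPoset b γ)).ncard := by
  rw [length_eq_ncard, inversionSet_idealElt, Set.ncard_image_of_injective _ idx_injective]

/-! ### Labels -/

/-- The label of `x`: the simple root to which `x` is moved by the element of the ideal of all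
smaller elements. -/
def label (x : RootPoset b γ) : b.support :=
  (exists_act_eq_simple (inversionSet_idealElt (LowerSet.Iio x)) (minOver_Iio x)).choose

lemma act_idealElt_Iio (x : RootPoset b γ) :
    act (idealElt (LowerSet.Iio x)) x.idx = label x :=
  (exists_act_eq_simple (inversionSet_idealElt (LowerSet.Iio x)) (minOver_Iio x)).choose_spec

lemma pairingIn_eq_zero_of_minOver {ν : LowerSet (RootPoset b γ)} {x y : RootPoset b γ}
    (hx : MinOver ν x) (hy : MinOver ν y) (hxy : x ≠ y) : P.pairingIn ℤ x.idx y.idx = 0 := by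
  refine le_antisymm ?_ (pairingIn_idx_mem x y).1
  obtain ⟨s, hs⟩ := exists_act_eq_simple (inversionSet_idealElt ν) hx
  obtain ⟨t, ht⟩ := exists_act_eq_simple (inversionSet_idealElt ν) hy
  rw [← pairingIn_act (idealElt ν), hs, ht]
  refine pairingIn_simple_nonpos ?_
  rintro rfl
  exact hxy (idx_injective (act_injective _ (hs.trans ht.symm)))

/-- The label of `x` can be computed from any ideal over which `x` is minimal. -/
lemma act_idealElt {ν : LowerSet (RootPoset b γ)} {x : RootPoset b γ} (hx : MinOver ν x) :
    act (idealElt ν) x.idx = label x := by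
  induction hn : (ν : Set (RootPoset b γ)).ncard using Nat.strong_induction_on generalizing ν with
  | _ n ih =>
    by_cases hle : ν ≤ LowerSet.Iio x
    · rw [le_antisymm hle fun y hy ↦ hx.2 y hy, act_idealElt_Iio]
    obtain ⟨y, hy, hyx, hmax⟩ := exists_maximal_notMem hle
    obtain ⟨ν', h1, h2, h3⟩ := exists_sup_Iic_eq hy hmax
    rw [LowerSet.mem_Iio_iff] at hyx
    have hne : x ≠ y := fun h ↦ hx.1 (h ▸ hy)
    have hx' : MinOver ν' x := ⟨fun h ↦ hx.1 ((h3 x).1 h).1,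
      fun z hz ↦ (h3 z).2 ⟨hx.2 z hz, fun h ↦ hyx (h ▸ hz)⟩⟩
    obtain ⟨s, hs⟩ := exists_act_eq_simple (inversionSet_idealElt ν') h1
    have hw := inversionSet_ofIdx_mul_of_act (inversionSet_idealElt ν') hs
    rw [← h1.coe_sup_Iic, h2] at hw
    have hxl : act (idealElt ν') x.idx = label x := by
      refine ih _ ?_ hx' rfl
      rw [← hn, ← h2, h1.coe_sup_Iic, Set.ncard_insert_of_notMem h1.1 (Set.toFinite _)]
      omega
    rw [idealElt_eq hw, act_mul, hxl]
    apply act_ofIdx_of_pairingIn_eq_zero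
    rw [← hxl, ← hs, pairingIn_act]
    exact pairingIn_eq_zero_of_minOver hx' h1 hne

lemma idealElt_sup_Iic {ν : LowerSet (RootPoset b γ)} {x : RootPoset b γ} (hx : MinOver ν x) :
    idealElt (ν ⊔ LowerSet.Iic x) = weylGroup.ofIdx P (label x) * idealElt ν := by
  apply idealElt_eq
  rw [inversionSet_ofIdx_mul_of_act (inversionSet_idealElt ν) (act_idealElt hx), hx.coe_sup_Iic]

lemma idealElt_bot : idealElt (⊥ : LowerSet (RootPoset b γ)) = 1 := by
  apply idealElt_eq
  ext i; simp [mem_inversionSet]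

lemma delta_eq_label (x : RootPoset b γ) : delta x = label x := by
  change neg P (act (idealElt (LowerSet.Iic x)) x.idx) = _
  rw [← Iio_sup_Iic, idealElt_sup_Iic (minOver_Iio x), act_mul, act_idealElt_Iio, act_ofIdx_self,
    neg_neg']

lemma pairingIn_label {ν : LowerSet (RootPoset b γ)} {x y : RootPoset b γ}
    (hx : MinOver ν x) (hy : MinOver ν y) :
    P.pairingIn ℤ (label x) (label y) = P.pairingIn ℤ x.idx y.idx := by
  rw [← act_idealElt hx, ← act_idealElt hy, pairingIn_act]

lemma exists_minOver_of_not_le {x y : RootPoset b γ} (h : ¬ x ≤ y) (h' : ¬ y ≤ x) :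
    ∃ ν : LowerSet (RootPoset b γ), MinOver ν x ∧ MinOver ν y := by
  refine ⟨LowerSet.Iio x ⊔ LowerSet.Iio y, ⟨?_, fun z hz ↦ ?_⟩, ⟨?_, fun z hz ↦ ?_⟩⟩ <;>
    simp only [LowerSet.mem_sup_iff, LowerSet.mem_Iio_iff, lt_irrefl, false_or, or_false]
  · exact fun h0 ↦ h h0.le
  · exact .inl hz
  · exact fun h0 ↦ h' h0.le
  · exact .inr hz

lemma pairingIn_eq_zero_of_not_le {x y : RootPoset b γ} (h : ¬ x ≤ y) (h' : ¬ y ≤ x) :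
    P.pairingIn ℤ x.idx y.idx = 0 := by
  obtain ⟨ν, hx, hy⟩ := exists_minOver_of_not_le h h'
  exact pairingIn_eq_zero_of_minOver hx hy fun h0 ↦ h h0.le

/-- Elements whose labels are not orthogonal are comparable. -/
lemma le_or_le_of_pairingIn_label_ne_zero {x y : RootPoset b γ}
    (h : P.pairingIn ℤ (label x) (label y) ≠ 0) : x ≤ y ∨ y ≤ x := by
  by_contra! h0
  obtain ⟨ν, hx, hy⟩ := exists_minOver_of_not_le h0.1 h0.2
  exact h ((pairingIn_label hx hy).trans (pairingIn_eq_zero_of_not_le h0.1 h0.2))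

/-- A root of the poset which is moved to a simple root by the element of an ideal is minimal among
the roots outside of the ideal. -/
lemma minOver_of_act {ν : LowerSet (RootPoset b γ)} {β : RootPoset b γ} {s : b.support}
    (h : act (idealElt ν) β.idx = s) : MinOver ν β := by
  refine ⟨fun hβ ↦ ?_, fun z hz ↦ ?_⟩
  · have : β.idx ∈ inversionSet b (idealElt ν) := by
      rw [inversionSet_idealElt]
      exact ⟨β, hβ, rfl⟩
    apply this.2
    change b.IsPos (act (idealElt ν) β.idx)
    rw [h]
    exact isPos_simple s
  · have h1 := inversionSet_ofIdx_mul_of_act (inversionSet_idealElt ν) h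
    obtain ⟨ν₁, hν₁⟩ := exists_lowerSet_of_inversionSet (γ := γ)
      (w := weylGroup.ofIdx P s * idealElt ν) (by
        rw [h1]
        rintro - ⟨y, -, rfl⟩
        exact coef_idx y)
    have h2 : (ν₁ : Set (RootPoset b γ)) = insert β (ν : Set (RootPoset b γ)) :=
      idx_injective.image_injective (hν₁.symm.trans h1)
    have h3 : z ∈ (ν₁ : Set (RootPoset b γ)) :=
      ν₁.lower hz.le (h2 ▸ Set.mem_insert _ _)
    rw [h2] at h3
    exact h3.resolve_left hz.ne

/-- The order on an ideal is generated by the pairs of elements with non-orthogonal labels. -/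
lemma lt_iff_exists_pairingIn_label {ν : LowerSet (RootPoset b γ)} {β : RootPoset b γ}
    (hβ : MinOver ν β) (x : RootPoset b γ) :
    x < β ↔ ∃ z ∈ ν, x ≤ z ∧ P.pairingIn ℤ (label z) (label β) ≠ 0 := by
  constructor
  · intro hx
    obtain ⟨z, hxz, hz⟩ := (Set.toFinite {z | z < β}).exists_le_maximal hx
    refine ⟨z, hβ.2 z hz.prop, hxz, fun h0 ↦ ?_⟩
    obtain ⟨ν₀, h1, h2, h3⟩ := exists_sup_Iic_eq (ν := LowerSet.Iio β) (β := z) hz.prop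
      fun y hy hzy ↦ hz.not_prop_of_gt hzy hy
    -- If the labels were orthogonal, then `β` could be added to the ideal before `z`.
    have h4 := act_idealElt_Iio β
    rw [← h2, idealElt_sup_Iic h1, act_mul] at h4
    have h5 : act (idealElt ν₀) β.idx = label β := by
      apply act_injective (weylGroup.ofIdx P (label z))
      rw [h4, act_ofIdx_of_pairingIn_eq_zero]
      rwa [pairingIn_eq_zero_comm]
    exact h1.1 ((minOver_of_act h5).2 z hz.prop)
  · rintro ⟨z, hz, hxz, h⟩
    refine hxz.trans_lt ?_
    rcases le_or_le_of_pairingIn_label_ne_zero h with h' | h'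
    · exact h'.lt_of_ne fun h0 ↦ hβ.1 (h0 ▸ hz)
    · exact absurd (ν.lower h' hz) hβ.1

/-- The action of the element of an ideal on a vector. -/
lemma idealElt_smul (ν : LowerSet (RootPoset b γ)) (v : M) :
    idealElt ν • v = v - ∑ y ∈ elts ν, P.coroot' y.idx v • P.root (label y) := by
  induction ν using lowerSet_induction with
  | bot => simp [idealElt_bot, elts]
  | step ν β h ih =>
    rw [idealElt_sup_Iic h, mul_smul, smul_ofIdx, reflection_apply, h.sum_elts,
      ← act_idealElt h, coroot'_act, ih, act_idealElt h]
    abel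

/-- The action of the inverse of the element of an ideal on a vector. -/
lemma idealElt_inv_smul (ν : LowerSet (RootPoset b γ)) (v : M) :
    (idealElt ν)⁻¹ • v = v - ∑ y ∈ elts ν, P.coroot' (label y) v • P.root y.idx := by
  induction ν using lowerSet_induction with
  | bot => simp [idealElt_bot, elts]
  | step ν β h ih =>
    have h' : (idealElt ν)⁻¹ • P.root (label β) = P.root β.idx := by
      rw [← act_idealElt h, root_act, inv_smul_smul]
    rw [idealElt_sup_Iic h, mul_inv_rev, ofIdx_inv, mul_smul, smul_ofIdx, reflection_apply,
      h.sum_elts, smul_sub, smul_comm _ (P.coroot' (label β) v), h', ih]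
    abel

lemma sqLength_label (x : RootPoset b γ) : sqLength P (label x) = sqLength P x.idx := by
  rw [← act_idealElt_Iio, sqLength_act]

lemma isLong_label (x : RootPoset b γ) : IsLong P (label x) ↔ IsLong P x.idx := by
  rw [← act_idealElt_Iio, isLong_act]

end Poset

/-! ### Chains in the poset -/

section Geometry

variable {ι M N : Type*} [AddCommGroup M] [Module ℝ M] [AddCommGroup N] [Module ℝ N]
  {P : RootPairing ι ℝ M N} [Fintype ι] [P.IsRootSystem] [P.IsCrystallographic] [P.IsReduced]
  {b : P.Base} {γ : b.support}

lemma sub_root_mem_cone {v : M} {a : b.support} (hv : v ∈ cone b) (ha : 0 < coef b a v) :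
    v - P.root a ∈ cone b := by
  rw [mem_cone_iff]
  intro s
  obtain ⟨n, hn⟩ := mem_cone_iff.1 hv s
  by_cases hs : s = a
  · subst hs
    rw [hn] at ha
    have : 1 ≤ n := by exact_mod_cast ha
    exact ⟨n - 1, by rw [map_sub, hn, coef_simple_self]; push_cast [this]; ring⟩
  · exact ⟨n, by rw [map_sub, hn, coef_simple_of_ne hs, sub_zero]⟩

lemma exists_form_pos {v : M} (hv : v ∈ cone b) (h : v ≠ 0) :
    ∃ a : b.support, 0 < coef b a v ∧ 0 < P.RootForm v (P.root a) := by
  by_contra! hcon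
  have h1 := form_pos (P := P) h
  have h2 : P.RootForm v v = ∑ a : b.support, coef b a v * P.RootForm v (P.root a) := by
    have h3 := congrArg (P.RootForm v) (sum_coef (b := b) v)
    rw [← h3, map_sum]
    refine Finset.sum_congr rfl fun a _ ↦ ?_
    rw [map_smul, smul_eq_mul]
  rw [h2] at h1
  refine h1.not_ge (Finset.sum_nonpos fun a _ ↦ ?_)
  rcases (coef_nonneg hv a).eq_or_lt with h0 | h0
  · rw [← h0, zero_mul]
  · exact mul_nonpos_of_nonneg_of_nonpos h0.le (hcon a h0)

lemma lt_of_root_eq_add {x y : RootPoset b γ} {a : b.support}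
    (h : P.root y.idx = P.root x.idx + P.root a) : x < y := by
  refine lt_of_le_of_ne ?_ fun h' ↦ ?_
  · rw [le_iff, h, add_sub_cancel_left]
    exact root_mem_cone a
  · subst h'
    exact P.ne_zero a (by simpa using h)

variable [hγ : Fact (IsCominuscule b γ)]

lemma ne_of_root_eq_add {x y : RootPoset b γ} {a : b.support}
    (h : P.root y.idx = P.root x.idx + P.root a) : a ≠ γ := by
  rintro rfl
  have := congrArg (coef b a) h
  rw [map_add, coef_idx, coef_idx, coef_simple_self] at this
  norm_num at this

lemma exists_root_eq_add {y : RootPoset b γ} {a : b.support} (ha : a ≠ γ)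
    (h : P.RootForm (P.root y.idx) (P.root a) < 0) :
    ∃ u : RootPoset b γ, P.root u.idx = P.root y.idx + P.root a := by
  rw [form_root_neg_iff] at h
  obtain ⟨i, hi⟩ := P.root_add_root_mem_of_pairingIn_neg h fun h0 ↦ by
    have := coef_idx y
    rw [h0, map_neg, coef_simple_of_ne ha.symm] at this
    norm_num at this
  exact ⟨ofCoef i (by rw [hi, map_add, coef_idx, coef_simple_of_ne ha.symm, add_zero]), hi⟩

lemma exists_root_eq_sub {y : RootPoset b γ} {a : b.support} (ha : a ≠ γ)
    (h : 0 < P.RootForm (P.root y.idx) (P.root a)) :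
    ∃ u : RootPoset b γ, P.root y.idx = P.root u.idx + P.root a := by
  rw [form_root_pos_iff] at h
  obtain ⟨i, hi⟩ := P.root_sub_root_mem_of_pairingIn_pos h fun h0 ↦ by
    have := coef_idx y
    rw [h0, coef_simple_of_ne ha.symm] at this
    norm_num at this
  exact ⟨ofCoef i (by rw [hi, map_sub, coef_idx, coef_simple_of_ne ha.symm, sub_zero]), by
    rw [idx_ofCoef, hi, sub_add_cancel]⟩

/-- Any two comparable elements are joined by a chain in which each step adds a simple root. -/
lemma exists_root_eq_add_of_lt {y z : RootPoset b γ} (h : y < z) :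
    ∃ (u : RootPoset b γ) (a : b.support), P.root u.idx = P.root y.idx + P.root a ∧ u ≤ z := by
  induction z using WellFoundedLT.induction with
  | _ z ih =>
    have hv := le_iff.1 h.le
    obtain ⟨a, ha, hpos⟩ := exists_form_pos hv (sub_ne_zero_of_lt h)
    have haγ : a ≠ γ := by
      rintro rfl
      rw [map_sub, coef_idx, coef_idx, sub_self] at ha
      exact ha.false
    have hsub := sub_root_mem_cone hv ha
    rw [map_sub, LinearMap.sub_apply] at hpos
    by_cases hy : P.RootForm (P.root y.idx) (P.root a) < 0
    · obtain ⟨u, hu⟩ := exists_root_eq_add haγ hy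
      refine ⟨u, a, hu, ?_⟩
      rwa [le_iff, hu, ← sub_sub]
    · obtain ⟨u, hu⟩ := exists_root_eq_sub (y := z) haγ (by linarith)
      have hyu : y ≤ u := by
        rw [le_iff]
        convert hsub using 1
        rw [hu]; abel
      rcases hyu.eq_or_lt with rfl | hlt
      · exact ⟨z, a, hu, le_rfl⟩
      · obtain ⟨u', a', h1, h2⟩ := ih u (lt_of_root_eq_add hu) hlt
        exact ⟨u', a', h1, h2.trans (lt_of_root_eq_add hu).le⟩

lemma ht_lt_of_lt {y z : RootPoset b γ} (h : y < z) :
    ht b (P.root y.idx) < ht b (P.root z.idx) := by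
  have := ht_pos (le_iff.1 h.le) (sub_ne_zero_of_lt h)
  rw [map_sub] at this
  linarith

/-- The possible lengths and inner products of two elements of the poset: both pairings lie between
`0` and `2`, and they are not both equal to `2`. -/
lemma form_cases {x y : RootPoset b γ} (h : x ≠ y) :
    P.RootForm (P.root x.idx) (P.root y.idx) = 0 ∨
    (P.RootForm (P.root x.idx) (P.root x.idx) = P.RootForm (P.root y.idx) (P.root y.idx) ∧
      2 * P.RootForm (P.root x.idx) (P.root y.idx) = P.RootForm (P.root y.idx) (P.root y.idx)) ∨
    (P.RootForm (P.root x.idx) (P.root x.idx) = 2 * P.RootForm (P.root y.idx) (P.root y.idx) ∧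
      P.RootForm (P.root x.idx) (P.root y.idx) = P.RootForm (P.root y.idx) (P.root y.idx)) ∨
    (P.RootForm (P.root y.idx) (P.root y.idx) = 2 * P.RootForm (P.root x.idx) (P.root x.idx) ∧
      P.RootForm (P.root x.idx) (P.root y.idx) = P.RootForm (P.root x.idx) (P.root x.idx)) := by
  have h1 := two_mul_form_root_root (P := P) x.idx y.idx
  have h2 := two_mul_form_root_root (P := P) y.idx x.idx
  rw [form_comm (P.root y.idx)] at h2
  obtain ⟨h3, h4⟩ := pairingIn_idx_mem x y
  obtain ⟨h5, h6⟩ := pairingIn_idx_mem y x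
  have h7 : ¬ (P.pairingIn ℤ x.idx y.idx = 2 ∧ P.pairingIn ℤ y.idx x.idx = 2) := by
    rw [P.pairingIn_two_two_iff]
    exact fun h0 ↦ h (idx_injective h0)
  generalize P.pairingIn ℤ x.idx y.idx = p at *
  generalize P.pairingIn ℤ y.idx x.idx = q at *
  have hx := form_root_pos (P := P) x.idx
  have hy := form_root_pos (P := P) y.idx
  interval_cases p <;> interval_cases q <;> simp at h1 h2 h7 <;>
    first
    | (left; linarith)
    | (right; left; constructor <;> linarith)
    | (right; right; left; constructor <;> linarith)
    | (right; right; right; constructor <;> linarith)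

/-! ### Twins -/

lemma form_add_self (x y : M) :
    P.RootForm (x + y) (x + y) = P.RootForm x x + 2 * P.RootForm x y + P.RootForm y y := by
  simp only [map_add, LinearMap.add_apply, form_comm y x]
  ring

lemma form_sub_self (x y : M) :
    P.RootForm (x - y) (x - y) = P.RootForm x x - 2 * P.RootForm x y + P.RootForm y y := by
  simp only [map_sub, LinearMap.sub_apply, form_comm y x]
  ring

lemma form_add_left (x y z : M) : P.RootForm (x + y) z = P.RootForm x z + P.RootForm y z := by
  simp only [map_add, LinearMap.add_apply]

/-- A root covered by another one in the poset is not orthogonal to it. -/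
lemma form_pos_of_root_eq_add {x y : RootPoset b γ} {a : b.support}
    (h : P.root y.idx = P.root x.idx + P.root a) :
    0 < P.RootForm (P.root x.idx) (P.root y.idx) := by
  have hx := form_root_pos (P := P) x.idx
  have hy := form_root_pos (P := P) y.idx
  rcases form_cases (lt_of_root_eq_add h).ne with h0 | ⟨-, h0⟩ | ⟨-, h0⟩ | ⟨-, h0⟩
  · -- reflecting `a` in `x` would give the root `x + y`
    exfalso
    have ha : P.root a = P.root y.idx - P.root x.idx := by rw [h, add_sub_cancel_left]
    have h1 : P.coroot' x.idx (P.root a) = -2 := by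
      have := two_mul_form_root (P := P) (P.root a) x.idx
      rw [ha, map_sub, LinearMap.sub_apply, form_comm, h0] at this
      rw [ha]
      apply mul_right_cancel₀ hx.ne'
      linarith
    have h2 : P.root (act (weylGroup.ofIdx P x.idx) a) = P.root y.idx + P.root x.idx := by
      rw [root_act, smul_ofIdx, reflection_apply, h1, ha]
      module
    have h3 := coef_root_le_one (γ := γ) (act (weylGroup.ofIdx P x.idx) a)
    rw [h2, map_add, coef_idx, coef_idx] at h3
    norm_num at h3
  all_goals linarith

section Twins

variable {β₁ β₂ x : RootPoset b γ} {a c : b.support} {m : ℝ}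

lemma form_sub_smul_self
    (h₀ : P.RootForm (P.root β₁.idx) (P.root β₂.idx) = 0)
    (hm₁ : P.RootForm (P.root β₁.idx) (P.root β₁.idx) = m)
    (hm₂ : P.RootForm (P.root β₂.idx) (P.root β₂.idx) = m) (v : M) (t : ℝ) :
    P.RootForm (P.root β₁.idx + P.root β₂.idx - t • v) (P.root β₁.idx + P.root β₂.idx - t • v) =
      2 * m - 2 * t * (P.RootForm v (P.root β₁.idx) + P.RootForm v (P.root β₂.idx)) +
        t ^ 2 * P.RootForm v v := by
  rw [form_sub_self, form_add_self, h₀, hm₁, hm₂]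
  simp only [map_smul, LinearMap.smul_apply, smul_eq_mul, map_add, LinearMap.add_apply]
  rw [form_comm (P.root β₁.idx) v, form_comm (P.root β₂.idx) v]
  ring

lemma root_add_root_sub_ne_zero (x y z : RootPoset b γ) :
    P.root x.idx + P.root y.idx - (1 : ℝ) • P.root z.idx ≠ 0 := by
  intro h
  have := congrArg (coef b γ) h
  rw [map_sub, map_add, map_smul, coef_idx, coef_idx, coef_idx] at this
  norm_num at this

/-- Two incomparable roots of equal length that cover the same root `x` have the same length
as `x`. -/
lemma form_of_twins (h₁ : P.root β₁.idx = P.root x.idx + P.root a)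
    (h₂ : P.root β₂.idx = P.root x.idx + P.root c)
    (h₀ : P.RootForm (P.root β₁.idx) (P.root β₂.idx) = 0)
    (hm₁ : P.RootForm (P.root β₁.idx) (P.root β₁.idx) = m)
    (hm₂ : P.RootForm (P.root β₂.idx) (P.root β₂.idx) = m) :
    P.RootForm (P.root x.idx) (P.root x.idx) = m ∧
      2 * P.RootForm (P.root x.idx) (P.root β₁.idx) = m ∧
      2 * P.RootForm (P.root x.idx) (P.root β₂.idx) = m := by
  have hm : 0 < m := hm₁ ▸ form_root_pos β₁.idx
  have hx := form_root_pos (P := P) x.idx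
  have p₁ := form_pos_of_root_eq_add h₁
  have p₂ := form_pos_of_root_eq_add h₂
  have c₁ := form_cases (lt_of_root_eq_add h₁).ne
  have c₂ := form_cases (lt_of_root_eq_add h₂).ne
  rw [hm₁] at c₁
  rw [hm₂] at c₂
  have n₂ : P.root β₁.idx + P.root β₂.idx - (2 : ℝ) • P.root x.idx ≠ 0 := by
    intro h
    have := congrArg (ht b) h
    rw [h₁, h₂, map_sub, map_add, map_smul, map_add, map_add, ht_simple, ht_simple, map_zero,
      smul_eq_mul] at this
    linarith
  -- the form is positive at `β₁ + β₂ - x` and at `β₁ + β₂ - 2 x`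
  have f₁ := form_pos (P := P) (root_add_root_sub_ne_zero β₁ β₂ x)
  have f₂ := form_pos (P := P) n₂
  rw [form_sub_smul_self h₀ hm₁ hm₂] at f₁ f₂
  rcases c₁ with c₁ | ⟨c₁, d₁⟩ | ⟨c₁, d₁⟩ | ⟨c₁, d₁⟩ <;>
    rcases c₂ with c₂ | ⟨c₂, d₂⟩ | ⟨c₂, d₂⟩ | ⟨c₂, d₂⟩ <;>
    first
    | (exfalso; linarith)
    | (refine ⟨?_, ?_, ?_⟩ <;> linarith)

/-- Twins, that is, elements with the same strict lower set, cover only one element: any simple root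
that can be subtracted from `β₁` is the one that leads to `x`. -/
lemma eq_of_covered_by_twins (h₁ : P.root β₁.idx = P.root x.idx + P.root a)
    (h₂ : P.root β₂.idx = P.root x.idx + P.root c) (hac : a ≠ c)
    (hlow : ∀ y, y < β₁ → y < β₂) {y : RootPoset b γ} {d : b.support}
    (hy : P.root β₁.idx = P.root y.idx + P.root d) : d = a := by
  obtain ⟨u, e, hu, hle⟩ := exists_root_eq_add_of_lt (hlow y (lt_of_root_eq_add hy))
  have hu₂ : u = β₂ := by
    by_contra hne
    have := ht_lt_of_lt (lt_of_le_of_ne hle hne)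
    rw [hu, h₂] at this
    rw [hy] at h₁
    have h₃ := congrArg (ht b) h₁
    simp only [map_add, ht_simple] at this h₃
    linarith
  subst hu₂
  have h3 : P.root d + P.root c = P.root a + P.root e := by
    rw [h₂] at hu
    rw [h₁] at hy
    have : P.root x.idx + (P.root d + P.root c) = P.root x.idx + (P.root a + P.root e) := by
      rw [add_comm (P.root d), ← add_assoc, hu, ← add_assoc, hy]
      abel
    exact add_left_cancel this
  by_contra hda
  have h4 := congrArg (coef b a) h3
  rw [map_add, map_add, coef_simple_of_ne (Ne.symm hda), coef_simple_of_ne hac,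
    coef_simple_self] at h4
  have h5 := coef_nonneg (root_mem_cone e) a
  linarith

lemma form_nonpos_of_twins (h₁ : P.root β₁.idx = P.root x.idx + P.root a)
    (h₂ : P.root β₂.idx = P.root x.idx + P.root c) (hac : a ≠ c)
    (hlow : ∀ y, y < β₁ → y < β₂) {d : b.support} (hd : d ≠ γ) (hda : d ≠ a) :
    P.RootForm (P.root β₁.idx) (P.root d) ≤ 0 := by
  by_contra! h
  obtain ⟨u, hu⟩ := exists_root_eq_sub hd h
  exact hda (eq_of_covered_by_twins h₁ h₂ hac hlow hu)

/-- If `u = y + a` lies below the twins, where `a` is the simple root with `β₁ = x + a`, then `y`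
cannot have twice their squared length: its reflection in `a` would be an equally long element
between `u` and `β₁`. -/
lemma false_of_long_of_lt_twins (h₁ : P.root β₁.idx = P.root x.idx + P.root a)
    (hm₁ : P.RootForm (P.root β₁.idx) (P.root β₁.idx) = m) {y u : RootPoset b γ}
    (ha : P.RootForm (P.root a) (P.root a) = m)
    (hu : P.root u.idx = P.root y.idx + P.root a) (hux : u ≤ x)
    (hum : P.RootForm (P.root u.idx) (P.root u.idx) = m)
    (hy : P.RootForm (P.root y.idx) (P.root y.idx) = 2 * m)
    (ih : ∀ z, y < z → z < β₁ → P.RootForm (P.root z.idx) (P.root z.idx) = m) : False := by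
  have hm : 0 < m := hm₁ ▸ form_root_pos β₁.idx
  have haγ := ne_of_root_eq_add hu
  rw [hu, form_add_self, hy, ha] at hum
  have h1 : P.coroot' a (P.root y.idx) = -2 := by
    have := two_mul_form_root (P := P) (P.root y.idx) a
    rw [ha] at this
    apply mul_right_cancel₀ hm.ne'
    linarith
  -- the reflection of `y` in `a` is a long root between `u` and `β₁`
  have h2 : P.root (act (weylGroup.ofIdx P a) y.idx) = P.root u.idx + P.root a := by
    rw [root_act, smul_ofIdx, reflection_apply, h1, hu]
    module
  let z : RootPoset b γ := ofCoef (act (weylGroup.ofIdx P a) y.idx) (by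
    rw [h2, map_add, coef_idx, coef_simple_of_ne haγ.symm, add_zero])
  have hz : P.root z.idx = P.root u.idx + P.root a := h2
  have hzm : P.RootForm (P.root z.idx) (P.root z.idx) = 2 * m := by
    rw [← hy]
    exact sqLength_act _ _
  have hzβ : z < β₁ := by
    refine lt_of_le_of_ne ?_ ?_
    · rw [le_iff, hz, h₁, add_sub_add_right_eq_sub]
      exact hux
    · intro h
      rw [h, hm₁] at hzm
      linarith
  have := ih z ((lt_of_root_eq_add hu).trans (lt_of_root_eq_add hz)) hzβ
  linarith

/-- All elements below two twins of equal length have the same length as the twins and make the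
same angle with both of them. This is proved from the top down, replacing `u = y + d` by `y`: the
values of the form at `u` and the positivity of the form at `β₁ + β₂ - y` and `β₁ + β₂ - 2 y` leave
no other possibility. -/
lemma form_of_lt_twins (h₁ : P.root β₁.idx = P.root x.idx + P.root a)
    (h₂ : P.root β₂.idx = P.root x.idx + P.root c) (hac : a ≠ c)
    (hlow : ∀ y, y < β₁ ↔ y < β₂)
    (h₀ : P.RootForm (P.root β₁.idx) (P.root β₂.idx) = 0)
    (hm₁ : P.RootForm (P.root β₁.idx) (P.root β₁.idx) = m)
    (hm₂ : P.RootForm (P.root β₂.idx) (P.root β₂.idx) = m) (y : RootPoset b γ) (hy : y < β₁) :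
    y ≤ x ∧ P.RootForm (P.root y.idx) (P.root y.idx) = m ∧
      2 * P.RootForm (P.root y.idx) (P.root β₁.idx) = m ∧
      2 * P.RootForm (P.root y.idx) (P.root β₂.idx) = m := by
  have hm : 0 < m := hm₁ ▸ form_root_pos β₁.idx
  obtain ⟨hxm, hx₁, hx₂⟩ := form_of_twins h₁ h₂ h₀ hm₁ hm₂
  have e₁ : P.root a = P.root β₁.idx - P.root x.idx := by rw [h₁, add_sub_cancel_left]
  have e₂ : P.root c = P.root β₂.idx - P.root x.idx := by rw [h₂, add_sub_cancel_left]
  have ha : P.RootForm (P.root a) (P.root a) = m := by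
    rw [e₁, form_sub_self, hxm, hm₁, form_comm]; linarith
  have hc : P.RootForm (P.root c) (P.root c) = m := by
    rw [e₂, form_sub_self, hxm, hm₂, form_comm]; linarith
  have a₁ : 2 * P.RootForm (P.root a) (P.root β₁.idx) = m := by
    rw [e₁, map_sub, LinearMap.sub_apply, hm₁]; linarith
  have a₂ : 2 * P.RootForm (P.root a) (P.root β₂.idx) = -m := by
    rw [e₁, map_sub, LinearMap.sub_apply, h₀]; linarith
  have c₁ : 2 * P.RootForm (P.root c) (P.root β₁.idx) = -m := by
    rw [e₂, map_sub, LinearMap.sub_apply, form_comm (P.root β₂.idx), h₀]; linarith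
  have c₂ : 2 * P.RootForm (P.root c) (P.root β₂.idx) = m := by
    rw [e₂, map_sub, LinearMap.sub_apply, hm₂]; linarith
  induction y using WellFoundedGT.induction with
  | _ y ih =>
    obtain ⟨u, d, hu, hle⟩ := exists_root_eq_add_of_lt hy
    rcases hle.eq_or_lt with rfl | hlt
    · have hda := eq_of_covered_by_twins h₁ h₂ hac (fun y ↦ (hlow y).1) hu
      subst hda
      have : y = x := idx_injective (P.root.injective (add_right_cancel (hu.symm.trans h₁)))
      subst this
      exact ⟨le_rfl, hxm, hx₁, hx₂⟩
    · have hyu := lt_of_root_eq_add hu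
      obtain ⟨hux, hum, hu₁, hu₂⟩ := ih u hyu hlt
      refine ⟨hyu.le.trans hux, ?_⟩
      have hdγ := ne_of_root_eq_add hu
      have f₁ := form_cases hy.ne
      have f₂ := form_cases ((hlow y).1 hy).ne
      have hY := form_root_pos (P := P) y.idx
      rw [hm₁] at f₁
      rw [hm₂] at f₂
      have g₁ : P.RootForm (P.root u.idx) (P.root β₁.idx) =
          P.RootForm (P.root y.idx) (P.root β₁.idx) + P.RootForm (P.root d) (P.root β₁.idx) := by
        rw [hu, form_add_left]
      have g₂ : P.RootForm (P.root u.idx) (P.root β₂.idx) =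
          P.RootForm (P.root y.idx) (P.root β₂.idx) + P.RootForm (P.root d) (P.root β₂.idx) := by
        rw [hu, form_add_left]
      by_cases hda : d = a
      · exfalso
        subst hda
        refine false_of_long_of_lt_twins h₁ hm₁ ha hu hux hum ?_
          fun z hz hz' ↦ (ih z hz hz').2.1
        rcases f₂ with f | ⟨f, f'⟩ | ⟨f, f'⟩ | ⟨f, f'⟩ <;> linarith
      by_cases hdc : d = c
      · exfalso
        subst hdc
        refine false_of_long_of_lt_twins h₂ hm₂ hc hu hux hum ?_
          fun z hz hz' ↦ (ih z hz ((hlow z).2 hz')).2.1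
        rcases f₁ with f | ⟨f, f'⟩ | ⟨f, f'⟩ | ⟨f, f'⟩ <;> linarith
      have d₁ := form_nonpos_of_twins h₁ h₂ hac (fun y ↦ (hlow y).1) hdγ hda
      have d₂ := form_nonpos_of_twins h₂ h₁ hac.symm (fun y ↦ (hlow y).2) hdγ hdc
      rw [form_comm] at d₁ d₂
      have n₂ : P.root β₁.idx + P.root β₂.idx - (2 : ℝ) • P.root y.idx ≠ 0 := by
        intro h
        have := congrArg (ht b) h
        have k₁ := ht_lt_of_lt hy
        have k₂ := ht_lt_of_lt ((hlow y).1 hy)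
        rw [map_sub, map_add, map_smul, map_zero, smul_eq_mul] at this
        linarith
      have q₁ := form_pos (P := P) (root_add_root_sub_ne_zero β₁ β₂ y)
      have q₂ := form_pos (P := P) n₂
      rw [form_sub_smul_self h₀ hm₁ hm₂] at q₁ q₂
      rcases f₁ with f₁ | ⟨f₁, f₁'⟩ | ⟨f₁, f₁'⟩ | ⟨f₁, f₁'⟩ <;>
        rcases f₂ with f₂ | ⟨f₂, f₂'⟩ | ⟨f₂, f₂'⟩ | ⟨f₂, f₂'⟩ <;>
        first
        | (exfalso; linarith)
        | (refine ⟨?_, ?_, ?_⟩ <;> linarith)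

end Twins

/-- The squared length of a sum of roots of squared length `m` is an integer multiple of `m`. -/
lemma exists_form_sum_eq {α : Type*} (s : Finset α) (g : α → ι) {m : ℝ}
    (h : ∀ y ∈ s, P.RootForm (P.root (g y)) (P.root (g y)) = m) :
    ∃ n : ℤ, P.RootForm (∑ y ∈ s, P.root (g y)) (∑ y ∈ s, P.root (g y)) = n * m := by
  classical
  induction s using Finset.induction_on with
  | empty => exact ⟨0, by simp⟩
  | insert y s hy ih =>
    obtain ⟨n, hn⟩ := ih fun z hz ↦ h z (Finset.mem_insert_of_mem hz)
    have hym := h y (Finset.mem_insert_self y s)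
    have h2 : 2 * P.RootForm (P.root (g y)) (∑ z ∈ s, P.root (g z)) =
        (∑ z ∈ s, P.pairingIn ℤ (g z) (g y) : ℤ) * m := by
      rw [form_comm, map_sum, LinearMap.sum_apply, Finset.mul_sum, Int.cast_sum, Finset.sum_mul]
      refine Finset.sum_congr rfl fun z _ ↦ ?_
      rw [two_mul_form_root_root, hym]
    refine ⟨1 + (∑ z ∈ s, P.pairingIn ℤ (g z) (g y)) + n, ?_⟩
    rw [Finset.sum_insert hy, form_add_self, hn, h2, hym]
    push_cast
    ring

/-- An element that has the same label as a smaller element is determined by its length and by the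
elements below it. Suppose that `β₁` and `β₂` are two such elements, of squared length `m`, and move
`β₁ + β₂` by the element of the ideal of all `y ≤ α`. The result is
`label β₁ + label β₂ + 2 ρ`, where `ρ` is the sum of the labels of the remaining `y < β₁`. The inner
products of `ρ` with the two labels and with itself, computed from `form_of_lt_twins`, force
`(ρ, ρ) = 3 m / 2`. But `ρ` is a sum of roots of squared length `m`, so that `(ρ, ρ)` is an integer
multiple of `m`. -/
theorem eq_of_twins {α β₁ β₂ : RootPoset b γ} (hlow : ∀ y, y < β₁ ↔ y < β₂)
    (hlen : sqLength P β₁.idx = sqLength P β₂.idx) (hα : α < β₂) (hlab : label α = label β₂) :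
    β₁ = β₂ := by
  classical
  by_contra hne
  obtain ⟨m, hm₁⟩ : ∃ m, sqLength P β₁.idx = m := ⟨_, rfl⟩
  have hm₂ := hlen.symm.trans hm₁
  have hα₁ := (hlow α).2 hα
  have hle₁ : ¬ β₁ ≤ β₂ := fun h ↦ ((hlow _).2 (lt_of_le_of_ne h hne)).false
  have hle₂ : ¬ β₂ ≤ β₁ := fun h ↦ ((hlow _).1 (lt_of_le_of_ne h (Ne.symm hne))).false
  have h₀ : P.RootForm (P.root β₁.idx) (P.root β₂.idx) = 0 :=
    form_eq_zero_iff.2 (pairingIn_eq_zero_of_not_le hle₁ hle₂)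
  -- a common element covered by both
  obtain ⟨x, hx⟩ := (Set.toFinite {z | z < β₁}).exists_maximal ⟨α, hα₁⟩
  have hcover (β : RootPoset b γ) (hβ : ∀ y, y < β → y < β₁) (hxβ : x < β) :
      ∃ a : b.support, P.root β.idx = P.root x.idx + P.root a := by
    obtain ⟨u, a, hu, hle⟩ := exists_root_eq_add_of_lt hxβ
    rcases hle.eq_or_lt with rfl | hlt
    · exact ⟨a, hu⟩
    · exact absurd (hβ u hlt) (hx.not_prop_of_gt (lt_of_root_eq_add hu))
  obtain ⟨a, h₁⟩ := hcover β₁ (fun _ ↦ id) hx.prop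
  obtain ⟨c, h₂⟩ := hcover β₂ (fun y ↦ (hlow y).2) ((hlow x).1 hx.prop)
  have hac : a ≠ c := by
    rintro rfl
    exact hne (idx_injective (P.root.injective (h₁.trans h₂.symm)))
  have hm : 0 < m := hm₁ ▸ form_root_pos β₁.idx
  have key := form_of_lt_twins h₁ h₂ hac hlow h₀ hm₁ hm₂
  -- the vector `V = β₁ + β₂` and its images
  have hIio : LowerSet.Iio β₂ = LowerSet.Iio β₁ := by
    ext y
    exact (hlow y).symm
  have hco (y : RootPoset b γ) (hy : y < β₁) :
      P.coroot' y.idx (P.root β₁.idx + P.root β₂.idx) = 2 := by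
    obtain ⟨-, k1, k2, k3⟩ := key y hy
    have := two_mul_form_root (P := P) (P.root β₁.idx + P.root β₂.idx) y.idx
    rw [form_add_left, form_comm _ (P.root y.idx), form_comm _ (P.root y.idx), k1] at this
    apply mul_right_cancel₀ hm.ne'
    linarith
  have hsmul (ν : LowerSet (RootPoset b γ)) (hν : ∀ y ∈ ν, y < β₁) :
      idealElt ν • (P.root β₁.idx + P.root β₂.idx) =
        P.root β₁.idx + P.root β₂.idx - (2 : ℝ) • ∑ y ∈ elts ν, P.root (label y) := by
    rw [idealElt_smul, Finset.smul_sum]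
    congr 1
    refine Finset.sum_congr rfl fun y hy ↦ ?_
    rw [hco y (hν y (mem_elts.1 hy))]
  obtain ⟨ρ, hρ⟩ : ∃ ρ, ρ = ∑ y ∈ (elts (LowerSet.Iio β₁)).filter (¬ · ≤ α),
    P.root (label y) := ⟨_, rfl⟩
  have hv : idealElt (LowerSet.Iic α) • (P.root β₁.idx + P.root β₂.idx) =
      P.root (label β₁) + P.root (label β₂) + (2 : ℝ) • ρ := by
    have e₁ := hsmul (LowerSet.Iio β₁) (fun y hy ↦ hy)
    have e₂ := hsmul (LowerSet.Iic α) (fun y hy ↦ lt_of_le_of_lt hy hα₁)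
    have e₃ : idealElt (LowerSet.Iio β₁) • (P.root β₁.idx + P.root β₂.idx) =
        P.root (label β₁) + P.root (label β₂) := by
      rw [smul_add, ← root_act, ← root_act, act_idealElt_Iio, ← hIio, act_idealElt_Iio]
    have e₄ := Finset.sum_filter_add_sum_filter_not (elts (LowerSet.Iio β₁)) (· ≤ α)
      (fun y ↦ P.root (label y))
    have e₅ : (elts (LowerSet.Iio β₁)).filter (· ≤ α) = elts (LowerSet.Iic α) := by
      ext y
      simp only [Finset.mem_filter, mem_elts, LowerSet.mem_Iio_iff, LowerSet.mem_Iic_iff]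
      exact ⟨And.right, fun h ↦ ⟨h.trans_lt hα₁, h⟩⟩
    rw [e₅, ← hρ] at e₄
    rw [e₁, ← e₄] at e₃
    rw [e₂, ← e₃]
    module
  have hwα : idealElt (LowerSet.Iic α) • P.root α.idx = -P.root (label β₂) := by
    rw [← Iio_sup_Iic, idealElt_sup_Iic (minOver_Iio α), mul_smul, ← root_act, act_idealElt_Iio,
      smul_ofIdx, reflection_apply_self, hlab]
  -- inner products
  have s₁ : P.RootForm (P.root (label β₁)) (P.root (label β₁)) = m := (sqLength_label β₁).trans hm₁
  have s₂ : P.RootForm (P.root (label β₂)) (P.root (label β₂)) = m := (sqLength_label β₂).trans hm₂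
  have s₀ : P.RootForm (P.root (label β₁)) (P.root (label β₂)) = 0 := by
    rw [← h₀, ← act_idealElt_Iio, ← act_idealElt_Iio, hIio, root_act, root_act, form_smul_smul]
  have t₂ : P.RootForm ρ (P.root (label β₂)) = -m := by
    have h3 := form_smul_smul (idealElt (LowerSet.Iic α)) (P.root β₁.idx + P.root β₂.idx)
      (P.root α.idx)
    obtain ⟨-, -, k2, k3⟩ := key α hα₁
    have hR : P.RootForm (P.root β₁.idx + P.root β₂.idx) (P.root α.idx) = m := by
      rw [form_add_left, form_comm (P.root β₁.idx), form_comm (P.root β₂.idx)]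
      linarith
    rw [hv, hwα, hR] at h3
    simp only [map_add, map_neg, map_smul, LinearMap.add_apply, LinearMap.smul_apply,
      smul_eq_mul] at h3
    rw [s₀, s₂] at h3
    linarith
  have tρ : P.RootForm ρ ρ = m - P.RootForm ρ (P.root (label β₁)) := by
    have h3 := form_smul_smul (idealElt (LowerSet.Iic α)) (P.root β₁.idx + P.root β₂.idx)
      (P.root β₁.idx + P.root β₂.idx)
    rw [hv, form_add_self (P.root β₁.idx), h₀, form_add_self _ ((2 : ℝ) • ρ), form_add_self, s₀,
      s₁, s₂] at h3
    change P.RootForm (P.root β₁.idx) (P.root β₁.idx) = m at hm₁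
    change P.RootForm (P.root β₂.idx) (P.root β₂.idx) = m at hm₂
    rw [hm₁, hm₂] at h3
    simp only [map_add, map_smul, LinearMap.add_apply, LinearMap.smul_apply,
      smul_eq_mul] at h3
    rw [form_comm (P.root (label β₁)), form_comm (P.root (label β₂)), t₂] at h3
    linarith
  have hρc : ρ ∈ cone b := by
    rw [hρ]
    exact AddSubmonoid.sum_mem _ fun y _ ↦ root_mem_cone _
  have p₁ := form_pos (P := P) (add_ne_zero_of_mem_cone hρc (root_mem_cone (label β₂))
    (P.ne_zero _))
  have p₂ := form_pos (P := P) (add_ne_zero_of_mem_cone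
    ((cone b).add_mem hρc (root_mem_cone (label β₂))) (root_mem_cone (label β₁)) (P.ne_zero _))
  rw [form_add_self, form_add_self ρ, form_add_left,
    form_comm (P.root (label β₂)) (P.root (label β₁)), s₀] at p₂
  rw [form_add_self] at p₁
  obtain ⟨k, hk⟩ : ∃ k : ℤ, 2 * P.RootForm ρ (P.root (label β₁)) = k * m := by
    refine ⟨∑ y ∈ (elts (LowerSet.Iio β₁)).filter (¬ · ≤ α),
      P.pairingIn ℤ (label y) (label β₁), ?_⟩
    rw [hρ, map_sum, LinearMap.sum_apply, Finset.mul_sum, Int.cast_sum, Finset.sum_mul]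
    refine Finset.sum_congr rfl fun z _ ↦ ?_
    rw [two_mul_form_root_root, s₁]
  obtain ⟨n, hn⟩ := exists_form_sum_eq ((elts (LowerSet.Iio β₁)).filter (¬ · ≤ α))
    (fun y ↦ (label y : ι)) (m := m) fun y hy ↦ by
      rw [Finset.mem_filter, mem_elts] at hy
      exact (sqLength_label y).trans (key y hy.1).2.1
  rw [← hρ] at hn
  -- the integer `k` would have to be `-1`, and `n = 3 / 2`
  have k1 : (k : ℝ) < 0 := by
    have : (k : ℝ) * m < 0 := by linarith
    exact neg_of_mul_neg_left this hm.le
  have k2 : (-2 : ℝ) < k := by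
    have : 0 < ((k : ℝ) + 2) * m := by linarith
    linarith [pos_of_mul_pos_left this hm.le]
  have k3 : 2 * (n : ℝ) = 2 - k := by
    apply mul_right_cancel₀ hm.ne'
    linarith
  norm_cast at k1 k2 k3
  omega

end Geometry

/-! ### Adding an element to an ideal -/

section Extension

variable {ι M N : Type*} [AddCommGroup M] [Module ℝ M] [AddCommGroup N] [Module ℝ N]
  {P : RootPairing ι ℝ M N} [Fintype ι] [P.IsRootSystem] [P.IsCrystallographic] [P.IsReduced]
  {b : P.Base} {γ : b.support}

/-- There are at most two root lengths. -/
lemma sqLength_eq_iff [P.IsIrreducible] {i j : ι} :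
    sqLength P i = sqLength P j ↔ (IsLong P i ↔ IsLong P j) := by
  refine ⟨fun h ↦ by simp only [IsLong, h], fun h ↦ ?_⟩
  by_cases hi : IsLong P i
  · exact le_antisymm (h.1 hi i) (hi j)
  · by_contra hne
    have hj := mt h.2 hi
    simp only [IsLong, not_forall, not_le] at hi hj
    obtain ⟨k, hk⟩ := hi
    obtain ⟨l, hl⟩ := hj
    have key := (P.posRootForm ℝ).toInvariantForm.apply_eq_or_of_apply_ne (i := i) (j := j) hne
    change ∀ k, sqLength P k = sqLength P i ∨ sqLength P k = sqLength P j at key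
    rcases key k with h1 | h1 <;> rcases key l with h2 | h2 <;> linarith

/-- The smallest element of the poset. -/
def bottom (γ : b.support) : RootPoset b γ := ⟨γ, RootLE.refl b γ⟩

lemma bottom_le (x : RootPoset b γ) : bottom γ ≤ x := x.2

lemma bottom_mem {ν : LowerSet (RootPoset b γ)} {x : RootPoset b γ} (h : x ∈ ν) :
    bottom γ ∈ ν := ν.lower (bottom_le x) h

variable [hγ : Fact (IsCominuscule b γ)]

lemma label_bottom : label (bottom γ) = γ := by
  apply Subtype.ext
  rw [← act_idealElt_Iio]
  have : LowerSet.Iio (bottom γ) = ⊥ := by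
    ext x
    simpa using fun h ↦ (bottom_le x).not_gt h
  rw [this, idealElt_bot, act_one]
  rfl

lemma coef_idealElt_inv_smul (ν : LowerSet (RootPoset b γ)) (s : b.support) :
    coef b γ ((idealElt ν)⁻¹ • P.root s) =
      coef b γ (P.root s) - ∑ y ∈ elts ν, (P.pairingIn ℤ s (label y) : ℝ) := by
  rw [idealElt_inv_smul, map_sub, map_sum]
  congr 1
  refine Finset.sum_congr rfl fun y _ ↦ ?_
  rw [map_smul, coef_idx, coroot'_root, smul_eq_mul, mul_one]

lemma coef_label_sub_sum {ν : LowerSet (RootPoset b γ)} {β : RootPoset b γ} (h : MinOver ν β) :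
    coef b γ (P.root (label β)) - ∑ y ∈ elts ν, (P.pairingIn ℤ (label β) (label y) : ℝ) = 1 := by
  rw [← coef_idealElt_inv_smul, ← act_idealElt h, root_act, inv_smul_smul, coef_idx]

/-- Whether `s` is the label of an element that can be added to `ν` can be read off from the labels
of `ν`. -/
lemma exists_label_eq {ν : LowerSet (RootPoset b γ)} {s : b.support}
    (h : coef b γ (P.root s) - ∑ y ∈ elts ν, (P.pairingIn ℤ s (label y) : ℝ) = 1) :
    ∃ β, MinOver ν β ∧ label β = s := by
  rw [← coef_idealElt_inv_smul, ← root_act] at h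
  have h1 : act (idealElt ν) (ofCoef _ h).idx = s := by rw [idx_ofCoef, act_act_inv]
  have h2 := minOver_of_act h1
  exact ⟨_, h2, Subtype.ext ((act_idealElt h2).symm.trans h1)⟩

lemma exists_eq_one_of_sum_eq_one {α : Type*} {s : Finset α} {a : α → ℤ} (h0 : ∀ x ∈ s, 0 ≤ a x)
    (h : ∑ x ∈ s, a x = 1) : ∃ x ∈ s, a x = 1 ∧ ∀ z ∈ s, z ≠ x → a z = 0 := by
  classical
  obtain ⟨x, hx, hax⟩ := Finset.exists_ne_zero_of_sum_ne_zero (h.trans_ne one_ne_zero)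
  have h1 := Finset.add_sum_erase s a hx
  have h2 : ∀ z ∈ s.erase x, 0 ≤ a z := fun z hz ↦ h0 z (Finset.mem_of_mem_erase hz)
  have h3 := Finset.sum_nonneg h2
  have h4 := h0 x hx
  have h5 : ∑ z ∈ s.erase x, a z = 0 := by omega
  refine ⟨x, hx, by omega, fun z hz hzx ↦ ?_⟩
  exact (Finset.sum_eq_zero_iff_of_nonneg h2).1 h5 z (Finset.mem_erase.2 ⟨hzx, hz⟩)

/-- An element with a new label covers exactly one element, and its label is orthogonal to all
labels below but one. -/
lemma exists_of_label_notMem {ν : LowerSet (RootPoset b γ)} {β : RootPoset b γ} (h : MinOver ν β)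
    (hne : ∃ x, x ∈ ν) (hnew : ∀ x ∈ ν, label x ≠ label β) :
    ∃ x ∈ ν, P.pairingIn ℤ (label β) (label x) = -1 ∧
      ∀ z ∈ ν, z ≠ x → P.pairingIn ℤ (label β) (label z) = 0 := by
  obtain ⟨g, hg⟩ := hne
  have h1 := coef_label_sub_sum h
  have h2 := hnew _ (bottom_mem hg)
  rw [label_bottom] at h2
  rw [coef_simple_of_ne h2, zero_sub, ← Finset.sum_neg_distrib] at h1
  obtain ⟨x, hx, h3, h4⟩ := exists_eq_one_of_sum_eq_one (s := elts ν)
    (a := fun y ↦ -P.pairingIn ℤ (label β) (label y))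
    (fun y hy ↦ neg_nonneg.2 (pairingIn_simple_nonpos (hnew y (mem_elts.1 hy)).symm))
    (by exact_mod_cast h1)
  refine ⟨x, mem_elts.1 hx, by omega, fun z hz hzx ↦ ?_⟩
  have := h4 z (mem_elts.2 hz) hzx
  omega

lemma lt_iff_le_of_pairingIn_label {ν : LowerSet (RootPoset b γ)} {β x : RootPoset b γ}
    (h : MinOver ν β) (hx : x ∈ ν) (h1 : P.pairingIn ℤ (label β) (label x) = -1)
    (h0 : ∀ z ∈ ν, z ≠ x → P.pairingIn ℤ (label β) (label z) = 0) (y : RootPoset b γ) :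
    y < β ↔ y ≤ x := by
  rw [lt_iff_exists_pairingIn_label h]
  constructor
  · rintro ⟨z, hz, hyz, hzβ⟩
    by_cases hzx : z = x
    · rwa [← hzx]
    · exact absurd (pairingIn_eq_zero_comm.1 (h0 z hz hzx)) hzβ
  · intro hy
    refine ⟨x, hx, hy, fun h2 ↦ ?_⟩
    rw [pairingIn_eq_zero_comm, h1] at h2
    omega

/-- The pairing in the other direction is determined by the lengths. -/
lemma pairingIn_label_of_forall [P.IsIrreducible] {ν : LowerSet (RootPoset b γ)}
    {β x : RootPoset b γ}
    (h : MinOver ν β) (hx : x ∈ ν) (h1 : P.pairingIn ℤ (label β) (label x) = -1)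
    (h0 : ∀ z ∈ ν, z ≠ x → P.pairingIn ℤ (label β) (label z) = 0) :
    (P.pairingIn ℤ (label x) (label β) = -1 ∨ P.pairingIn ℤ (label x) (label β) = -2) ∧
      (P.pairingIn ℤ (label x) (label β) = -1 ↔ (IsLong P x.idx ↔ IsLong P β.idx)) := by
  have hlt := lt_iff_le_of_pairingIn_label h hx h1 h0
  have hI : LowerSet.Iio β = LowerSet.Iic x := by
    ext y
    exact hlt y
  have hβ := act_idealElt_Iio β
  have hx' : idealElt (LowerSet.Iic x) • P.root x.idx = -P.root (label x) := by
    rw [← Iio_sup_Iic, idealElt_sup_Iic (minOver_Iio x), mul_smul, ← root_act, act_idealElt_Iio,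
      smul_ofIdx, reflection_apply_self]
  rw [hI] at hβ
  have e1 := form_smul_smul (idealElt (LowerSet.Iic x)) (P.root x.idx) (P.root β.idx)
  rw [hx', ← root_act, hβ, map_neg, LinearMap.neg_apply] at e1
  have e2 := two_mul_form_root_root (P := P) x.idx β.idx
  have e3 := two_mul_form_root_root (P := P) (label x) (label β)
  have e4 := two_mul_form_root_root (P := P) (label β) (label x)
  have l1 := sqLength_label x
  have l2 := sqLength_label β
  rw [← sqLength_eq_iff]
  have hpos : 0 < sqLength P β.idx := form_root_pos β.idx
  have hpos' : 0 < sqLength P x.idx := form_root_pos x.idx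
  change _ = _ * sqLength P (label x) at e4
  change _ = _ * sqLength P (label β) at e3
  change _ = _ * sqLength P β.idx at e2
  rw [h1, form_comm, l1] at e4
  rw [l2] at e3
  have e5 : P.pairingIn ℤ x.idx β.idx = -P.pairingIn ℤ (label x) (label β) := by
    have : (P.pairingIn ℤ x.idx β.idx : ℝ) = -P.pairingIn ℤ (label x) (label β) := by
      apply mul_right_cancel₀ hpos.ne'
      linarith
    exact_mod_cast this
  obtain ⟨b1, b2⟩ := pairingIn_idx_mem x β
  have hne : P.pairingIn ℤ (label x) (label β) ≠ 0 := by
    intro h2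
    rw [h2, Int.cast_zero, zero_mul] at e3
    rw [e3] at e4
    push_cast at e4
    linarith
  refine ⟨by omega, fun h2 ↦ ?_, fun h2 ↦ ?_⟩
  · rw [h2] at e3
    push_cast at e3 e4
    linarith
  · have : (P.pairingIn ℤ (label x) (label β) : ℝ) = -1 := by
      apply mul_right_cancel₀ hpos.ne'
      rw [← e3, e4, h2]
      push_cast
      ring
    exact_mod_cast this

end Extension

/-! ### Isomorphisms of labeled posets preserve the pairings of labels -/

section LabeledIso

variable {ι M N ι' M' N' : Type*} [AddCommGroup M] [Module ℝ M] [AddCommGroup N] [Module ℝ N]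
  [AddCommGroup M'] [Module ℝ M'] [AddCommGroup N'] [Module ℝ N']
  {P : RootPairing ι ℝ M N} [Fintype ι] [P.IsRootSystem] [P.IsCrystallographic] [P.IsReduced]
  [P.IsIrreducible] {b : P.Base} {γ : b.support}
  {P' : RootPairing ι' ℝ M' N'} [Fintype ι'] [P'.IsRootSystem] [P'.IsCrystallographic]
  [P'.IsReduced] [P'.IsIrreducible] {b' : P'.Base} {γ' : b'.support}

/-- `F` and `G` restrict to mutually inverse isomorphisms of labeled posets between the lower sets
`ν` and `ν'`. (Using functions defined on all of the posets makes it easy to shrink `ν`.) -/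
structure IsLabeledIso (ν : LowerSet (RootPoset b γ)) (ν' : LowerSet (RootPoset b' γ'))
    (F : RootPoset b γ → RootPoset b' γ') (G : RootPoset b' γ' → RootPoset b γ) : Prop where
  mem : ∀ x ∈ ν, F x ∈ ν'
  mem' : ∀ y ∈ ν', G y ∈ ν
  left : ∀ x ∈ ν, G (F x) = x
  right : ∀ y ∈ ν', F (G y) = y
  le_iff : ∀ x ∈ ν, ∀ y ∈ ν, F x ≤ F y ↔ x ≤ y
  long : ∀ x ∈ ν, IsLong P x.idx ↔ IsLong P' (F x).idx

/-- `F` preserves the pairings between the labels of the elements of `ν`. -/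
def PreservesPairing [Fact (IsCominuscule b γ)] [Fact (IsCominuscule b' γ')]
    (ν : LowerSet (RootPoset b γ)) (F : RootPoset b γ → RootPoset b' γ') : Prop :=
  ∀ x ∈ ν, ∀ y ∈ ν,
    P'.pairingIn ℤ (label (F x)) (label (F y)) = P.pairingIn ℤ (label x) (label y)

namespace IsLabeledIso

variable {ν : LowerSet (RootPoset b γ)} {ν' : LowerSet (RootPoset b' γ')}
    {F : RootPoset b γ → RootPoset b' γ'} {G : RootPoset b' γ' → RootPoset b γ}

lemma symm (h : IsLabeledIso ν ν' F G) : IsLabeledIso ν' ν G F where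
  mem := h.mem'
  mem' := h.mem
  left := h.right
  right := h.left
  le_iff x hx y hy := by rw [← h.le_iff _ (h.mem' x hx) _ (h.mem' y hy), h.right x hx, h.right y hy]
  long x hx := by rw [h.long _ (h.mem' x hx), h.right x hx]

lemma lt_iff (h : IsLabeledIso ν ν' F G) {x y : RootPoset b γ} (hx : x ∈ ν) (hy : y ∈ ν) :
    F x < F y ↔ x < y := by
  rw [lt_iff_le_not_ge, lt_iff_le_not_ge, h.le_iff x hx y hy, h.le_iff y hy x hx]

lemma bottom (h : IsLabeledIso ν ν' F G) {x : RootPoset b γ} (hx : x ∈ ν) :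
    F (bottom γ) = Cominuscule.bottom γ' := by
  have hg := bottom_mem (h.mem x hx)
  refine le_antisymm ?_ (bottom_le _)
  rw [← h.right _ hg, h.le_iff _ (bottom_mem hx) _ (h.mem' _ hg)]
  exact bottom_le _

/-- A labeled isomorphism restricts to the complement of a maximal element. -/
lemma restrict {β : RootPoset b γ} (h : IsLabeledIso (ν ⊔ LowerSet.Iic β) ν' F G)
    (hβ : MinOver ν β) : ∃ μ, MinOver μ (F β) ∧ IsLabeledIso ν μ F G := by
  have hm : β ∈ ν ⊔ LowerSet.Iic β := hβ.mem_sup_Iic.2 (.inl rfl)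
  have hsub {x : RootPoset b γ} (hx : x ∈ ν) : x ∈ ν ⊔ LowerSet.Iic β :=
    hβ.mem_sup_Iic.2 (.inr hx)
  obtain ⟨μ, h1, -, h3⟩ := exists_sup_Iic_eq (h.mem β hm) fun y hy hlt ↦ by
    rw [← h.right y hy, h.lt_iff hm (h.mem' y hy)] at hlt
    rcases hβ.mem_sup_Iic.1 (h.mem' y hy) with h4 | h4
    · exact hlt.ne' h4
    · exact hβ.1 (ν.lower hlt.le h4)
  have hμ {x : RootPoset b γ} (hx : x ∈ ν) : F x ∈ μ :=
    (h3 _).2 ⟨h.mem x (hsub hx), fun h4 ↦ hβ.1 (by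
      rwa [← h.left β hm, ← h4, h.left x (hsub hx)])⟩
  refine ⟨μ, h1, fun x ↦ hμ, fun y hy ↦ ?_, fun x hx ↦ h.left x (hsub hx),
    fun y hy ↦ h.right y ((h3 y).1 hy).1, fun x hx y hy ↦ h.le_iff x (hsub hx) y (hsub hy),
    fun x hx ↦ h.long x (hsub hx)⟩
  obtain ⟨h4, h5⟩ := (h3 y).1 hy
  refine (hβ.mem_sup_Iic.1 (h.mem' y h4)).resolve_left fun h6 ↦ h5 ?_
  rw [← h6, h.right y h4]

variable [Fact (IsCominuscule b γ)] [Fact (IsCominuscule b' γ')]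

lemma preservesPairing_symm (h : IsLabeledIso ν ν' F G) (hC : PreservesPairing ν F) :
    PreservesPairing ν' G := by
  intro x hx y hy
  rw [← hC _ (h.mem' x hx) _ (h.mem' y hy), h.right x hx, h.right y hy]

lemma label_eq_iff (hC : PreservesPairing ν F) {x y : RootPoset b γ} (hx : x ∈ ν) (hy : y ∈ ν) :
    label (F x) = label (F y) ↔ label x = label y := by
  rw [← pairingIn_simple_eq_two_iff, hC x hx y hy, pairingIn_simple_eq_two_iff]

lemma coef_label (h : IsLabeledIso ν ν' F G) (hC : PreservesPairing ν F) {x : RootPoset b γ}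
    (hx : x ∈ ν) :
    coef b' γ' (P'.root (label (F x))) = coef b γ (P.root (label x)) := by
  have h1 := label_eq_iff hC hx (bottom_mem hx)
  rw [h.bottom hx, label_bottom, label_bottom] at h1
  by_cases h2 : label x = γ
  · rw [h1.2 h2, h2, coef_simple_self, coef_simple_self]
  · rw [coef_simple_of_ne (Ne.symm h2), coef_simple_of_ne (Ne.symm (mt h1.1 h2))]

/-- If the label of an added element is not new, then it is determined: by `eq_of_twins`, the
element with this label that can be added on the other side must be the image. -/
lemma label_eq_of_label_eq (h : IsLabeledIso ν ν' F G) (hC : PreservesPairing ν F)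
    {β : RootPoset b γ} {β' : RootPoset b' γ'} (hβ : MinOver ν β) (hβ' : MinOver ν' β')
    (hlt : ∀ x ∈ ν, x < β ↔ F x < β') (hlong : IsLong P β.idx ↔ IsLong P' β'.idx)
    {y : RootPoset b γ} (hy : y ∈ ν) (hlab : label y = label β) : label (F y) = label β' := by
  have h1 := coef_label_sub_sum hβ
  rw [← hlab, ← h.coef_label hC hy] at h1
  have h2 : ∑ z ∈ elts ν, (P.pairingIn ℤ (label y) (label z) : ℝ) =
      ∑ z ∈ elts ν', (P'.pairingIn ℤ (label (F y)) (label z) : ℝ) := by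
    refine Finset.sum_nbij' F G (fun x hx ↦ ?_) (fun x hx ↦ ?_) (fun x hx ↦ ?_) (fun x hx ↦ ?_)
      (fun x hx ↦ ?_) <;> rw [mem_elts] at hx
    · exact mem_elts.2 (h.mem x hx)
    · exact mem_elts.2 (h.mem' x hx)
    · exact h.left x hx
    · exact h.right x hx
    · rw [hC y hy x hx]
  rw [h2] at h1
  obtain ⟨β'', hβ'', hlab''⟩ := exists_label_eq h1
  have hlow : ∀ z, z < β' ↔ z < β'' := by
    intro z
    by_cases hz : z ∈ ν'
    · have h3 := hlt _ (h.mem' z hz)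
      rw [h.right z hz] at h3
      rw [← h3, lt_iff_exists_pairingIn_label hβ, lt_iff_exists_pairingIn_label hβ'', hlab'']
      constructor
      · rintro ⟨u, hu, hzu, hne⟩
        refine ⟨F u, h.mem u hu, ?_, ?_⟩
        · rwa [← h.right z hz, h.le_iff _ (h.mem' z hz) _ hu]
        · rwa [hC u hu y hy, hlab]
      · rintro ⟨u, hu, hzu, hne⟩
        refine ⟨G u, h.mem' u hu, ?_, ?_⟩
        · rwa [← h.le_iff _ (h.mem' z hz) _ (h.mem' u hu), h.right z hz, h.right u hu]
        · rwa [← hlab, ← hC _ (h.mem' u hu) y hy, h.right u hu]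
    · exact iff_of_false (fun h3 ↦ hz (hβ'.2 z h3)) (fun h3 ↦ hz (hβ''.2 z h3))
  have hlen : sqLength P' β'.idx = sqLength P' β''.idx := by
    rw [sqLength_eq_iff, ← hlong, ← isLong_label β'', hlab'', isLong_label, ← h.long y hy,
      ← isLong_label y, hlab, isLong_label]
  have hα : F y < β'' := by
    rw [lt_iff_exists_pairingIn_label hβ'']
    exact ⟨F y, h.mem y hy, le_rfl, by simp [hlab'']⟩
  rw [eq_of_twins hlow hlen hα hlab''.symm, hlab'']

lemma preservesPairing_step (h : IsLabeledIso ν ν' F G) (hC : PreservesPairing ν F)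
    {β : RootPoset b γ} {β' : RootPoset b' γ'} (hβ : MinOver ν β) (hβ' : MinOver ν' β')
    (hlt : ∀ x ∈ ν, x < β ↔ F x < β') (hlong : IsLong P β.idx ↔ IsLong P' β'.idx)
    {y : RootPoset b γ} (hy : y ∈ ν) :
    P'.pairingIn ℤ (label β') (label (F y)) = P.pairingIn ℤ (label β) (label y) ∧
      P'.pairingIn ℤ (label (F y)) (label β') = P.pairingIn ℤ (label y) (label β) := by
  by_cases hold : ∃ z ∈ ν, label z = label β
  · obtain ⟨z, hz, hlab⟩ := hold
    rw [← h.label_eq_of_label_eq hC hβ hβ' hlt hlong hz hlab, ← hlab]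
    exact ⟨hC z hz y hy, hC y hy z hz⟩
  by_cases hold' : ∃ z ∈ ν', label z = label β'
  · obtain ⟨z, hz, hlab⟩ := hold'
    have := h.symm.label_eq_of_label_eq (h.preservesPairing_symm hC) hβ' hβ
      (fun x hx ↦ by rw [hlt _ (h.mem' x hx), h.right x hx]) hlong.symm hz hlab
    exact absurd ⟨_, h.mem' z hz, this⟩ hold
  push Not at hold hold'
  obtain ⟨x, hx, h1, h2⟩ := exists_of_label_notMem hβ ⟨y, hy⟩ hold
  obtain ⟨x', hx', h1', h2'⟩ := exists_of_label_notMem hβ' ⟨_, h.mem y hy⟩ hold'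
  have hle := lt_iff_le_of_pairingIn_label hβ hx h1 h2
  have hle' := lt_iff_le_of_pairingIn_label hβ' hx' h1' h2'
  have hxx : F x = x' := by
    apply le_antisymm
    · rw [← hle', ← hlt x hx, hle]
    · rw [← h.right x' hx', h.le_iff _ (h.mem' x' hx') x hx, ← hle, hlt _ (h.mem' x' hx'),
        h.right x' hx', hle']
  subst hxx
  by_cases hyx : y = x
  · subst hyx
    obtain ⟨h3, h4⟩ := pairingIn_label_of_forall hβ hx h1 h2
    obtain ⟨h3', h4'⟩ := pairingIn_label_of_forall hβ' hx' h1' h2'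
    rw [← hlong, ← h.long y hy, ← h4] at h4'
    exact ⟨by rw [h1, h1'], by omega⟩
  · have hyx' : F y ≠ F x := fun h3 ↦ hyx (by rw [← h.left y hy, h3, h.left x hx])
    have e := h2 y hy hyx
    have e' := h2' _ (h.mem y hy) hyx'
    rw [e, e', pairingIn_eq_zero_comm.1 e, pairingIn_eq_zero_comm.1 e']
    exact ⟨rfl, rfl⟩

/-- Isomorphisms of labeled posets preserve the pairings between labels. -/
theorem preservesPairing (h : IsLabeledIso ν ν' F G) : PreservesPairing ν F := by
  induction ν using lowerSet_induction generalizing ν' with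
  | bot => exact fun x hx ↦ absurd hx (by simp)
  | step ν β hβ ih =>
    obtain ⟨μ, hμ, h'⟩ := h.restrict hβ
    have hC := ih h'
    have hm : β ∈ ν ⊔ LowerSet.Iic β := hβ.mem_sup_Iic.2 (.inl rfl)
    have key {y : RootPoset b γ} (hy : y ∈ ν) :=
      h'.preservesPairing_step hC hβ hμ
        (fun x hx ↦ (h.lt_iff (hβ.mem_sup_Iic.2 (.inr hx)) hm).symm) (h.long β hm) hy
    intro x hx y hy
    rw [hβ.mem_sup_Iic] at hx hy
    rcases hx with rfl | hx <;> rcases hy with rfl | hy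
    · simp
    · exact (key hy).1
    · exact (key hx).2
    · exact hC x hx y hy

end IsLabeledIso

end LabeledIso

/-! ### Reduced decompositions of the elements of ideals -/

section ReducedDecompositions

variable {ι M N : Type*} [AddCommGroup M] [Module ℝ M] [AddCommGroup N] [Module ℝ N]
  {P : RootPairing ι ℝ M N} [Fintype ι] [P.IsRootSystem] [P.IsCrystallographic] [P.IsReduced]
  {b : P.Base} {γ : b.support}

/-- The list `L` is a linear extension of `ν`, written with the largest element first. -/
def IsEnum (ν : LowerSet (RootPoset b γ)) (L : List (RootPoset b γ)) : Prop :=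
  (∀ x, x ∈ L ↔ x ∈ ν) ∧ L.Pairwise (¬ · ≤ ·)

variable [hγ : Fact (IsCominuscule b γ)]

lemma isReduced_of_isEnum {ν : LowerSet (RootPoset b γ)} {L : List (RootPoset b γ)}
    (h : IsEnum ν L) :
    wordProd b (L.map label) = idealElt ν ∧ (L.map label).length = length b (idealElt ν) := by
  induction L generalizing ν with
  | nil =>
    have : ν = ⊥ := by
      ext x
      simpa using (h.1 x).symm
    subst this
    exact ⟨idealElt_bot.symm, by simp [length_idealElt]⟩
  | cons x L ih =>
    obtain ⟨h1, h2⟩ := h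
    rw [List.pairwise_cons] at h2
    obtain ⟨ν', h3, h4, h5⟩ := exists_sup_Iic_eq (ν := ν) (β := x) ((h1 x).1 (by simp)) (by
      intro y hy hlt
      rcases List.mem_cons.1 ((h1 y).2 hy) with h4 | h4
      · exact hlt.ne' h4
      · exact h2.1 y h4 hlt.le)
    obtain ⟨h6, h7⟩ := ih (ν := ν') ⟨fun z ↦ by
      rw [h5, ← h1, List.mem_cons]
      refine ⟨fun h6 ↦ ⟨.inr h6, ?_⟩, fun h6 ↦ h6.1.resolve_left h6.2⟩
      rintro rfl
      exact h2.1 z h6 le_rfl, h2.2⟩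
    rw [length_idealElt] at h7 ⊢
    rw [← h4, List.map_cons, wordProd_cons, h6, idealElt_sup_Iic h3, List.length_cons, h7,
      h3.coe_sup_Iic, Set.ncard_insert_of_notMem h3.1 (Set.toFinite _)]
    exact ⟨rfl, rfl⟩

lemma exists_isEnum_of_isReduced {ν : LowerSet (RootPoset b γ)} {l : List b.support}
    (h1 : wordProd b l = idealElt ν) (h2 : l.length = length b (idealElt ν)) :
    ∃ L, IsEnum ν L ∧ L.map label = l := by
  induction l generalizing ν with
  | nil =>
    refine ⟨[], ⟨fun x ↦ ?_, List.Pairwise.nil⟩, rfl⟩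
    rw [length_idealElt, List.length_nil, eq_comm, Set.ncard_eq_zero (Set.toFinite _)] at h2
    rw [← SetLike.mem_coe, h2]
    simp
  | cons s l ih =>
    rw [← h1] at h2
    have h3 := inversionSet_idealElt ν
    rw [← h1, wordProd_cons, inversionSet_ofIdx_mul (isPos_of_reduced_cons h2)] at h3
    have h4 : ∀ i ∈ inversionSet b (wordProd b l), coef b γ (P.root i) = 1 := by
      intro i hi
      have : i ∈ RootPoset.idx '' (ν : Set (RootPoset b γ)) := h3 ▸ Set.mem_insert_of_mem _ hi
      obtain ⟨x, -, rfl⟩ := this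
      exact coef_idx x
    obtain ⟨ν', h5⟩ := exists_lowerSet_of_inversionSet h4
    have h6 := idealElt_eq h5
    have : act (wordProd b l)⁻¹ s ∈ RootPoset.idx '' (ν : Set (RootPoset b γ)) :=
      h3 ▸ Set.mem_insert _ _
    obtain ⟨β, hβ, hβs⟩ := this
    have h7 : act (idealElt ν') β.idx = s := by rw [h6, hβs, act_act_inv]
    have h8 := minOver_of_act h7
    obtain ⟨L, ⟨hL, hL'⟩, rfl⟩ := ih h6.symm (by rw [h6]; exact reduced_tail h2)
    rw [h5, ← hβs, ← Set.image_insert_eq] at h3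
    have h9 := idx_injective.image_injective h3
    refine ⟨β :: L, ⟨fun x ↦ ?_, ?_⟩, ?_⟩
    · rw [List.mem_cons, hL, ← SetLike.mem_coe (p := ν), ← h9]
      rfl
    · exact List.pairwise_cons.2 ⟨fun y hy hle ↦ h8.1 (ν'.lower hle ((hL y).1 hy)), hL'⟩
    · rw [List.map_cons, Subtype.ext ((act_idealElt h8).symm.trans h7)]

/-- The reduced decompositions of the element of an ideal are the linear extensions of the ideal,
with each element replaced by its label. -/
theorem mem_reducedDecompositions_iff {ν : LowerSet (RootPoset b γ)} {l : List b.support} :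
    l ∈ reducedDecompositions b (idealElt ν) ↔ ∃ L, IsEnum ν L ∧ L.map label = l := by
  constructor
  · rintro ⟨h1, h2⟩
    exact exists_isEnum_of_isReduced h1 h2
  · rintro ⟨L, hL, rfl⟩
    exact isReduced_of_isEnum hL

lemma mem_supp_of_mem {ν : LowerSet (RootPoset b γ)} {l : List b.support}
    (hl : l ∈ reducedDecompositions b (idealElt ν)) {s : b.support} (hs : s ∈ l) : s ∈ supp ν := by
  obtain ⟨h1, h2⟩ := hl
  rw [← h1] at h2
  change BruhatLE b _ _
  rw [← h1]
  exact bruhatLE_of_mem_reduced hs h2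

lemma mem_supp_iff {ν : LowerSet (RootPoset b γ)} {s : b.support} :
    s ∈ supp ν ↔ ∃ x ∈ ν, label x = s := by
  obtain ⟨l, h1, h2⟩ := exists_reduced_word b (idealElt ν)
  obtain ⟨L, hL, rfl⟩ := exists_isEnum_of_isReduced h1 h2
  have h3 : s ∈ L.map label ↔ ∃ x ∈ ν, label x = s := by simp [hL.1]
  rw [← h3]
  refine ⟨fun hs ↦ mem_of_bruhatLE (l := L.map label) ?_, mem_supp_of_mem ⟨h1, h2⟩⟩
  rw [h1]
  exact hs

lemma label_mem_supp {ν : LowerSet (RootPoset b γ)} {x : RootPoset b γ} (hx : x ∈ ν) :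
    label x ∈ supp ν := mem_supp_iff.2 ⟨x, hx, rfl⟩

/-- The arrows of a Dynkin diagram can be read off from the Cartan matrix. -/
lemma arrow_dynkinDiagram {s t : b.support} : (dynkinDiagram b).arrow s t ↔
    s ≠ t ∧ 1 < P.pairingIn ℤ s t * P.pairingIn ℤ t s ∧
      P.pairingIn ℤ s t < P.pairingIn ℤ t s := by
  change (s ≠ t ∧ 1 < P.pairingIn ℤ s t * P.pairingIn ℤ t s ∧ _) ↔ _
  refine and_congr_right fun hne ↦ and_congr_right fun hw ↦ ?_
  have h1 := two_mul_form_root_root (P := P) s t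
  have h2 := two_mul_form_root_root (P := P) t s
  change _ = _ * sqLength P t at h1
  change _ = _ * sqLength P s at h2
  rw [form_comm, h1] at h2
  have hs : 0 < sqLength P s := form_root_pos _
  have ht : 0 < sqLength P t := form_root_pos _
  have p1 : (P.pairingIn ℤ t s : ℝ) < 0 := by
    have h3 := pairingIn_simple_nonpos hne.symm
    have h4 : P.pairingIn ℤ t s ≠ 0 := by
      intro h4
      rw [h4] at hw
      simp at hw
    exact_mod_cast lt_of_le_of_ne h3 h4
  rw [← Int.cast_lt (R := ℝ)]
  constructor
  · intro h
    by_contra! hle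
    nlinarith
  · intro h
    by_contra! hle
    nlinarith

end ReducedDecompositions

/-! ### The isomorphism of Dynkin diagrams -/

section DiagramIso

variable {ι M N ι' M' N' : Type*} [AddCommGroup M] [Module ℝ M] [AddCommGroup N] [Module ℝ N]
  [AddCommGroup M'] [Module ℝ M'] [AddCommGroup N'] [Module ℝ N']
  {P : RootPairing ι ℝ M N} [Fintype ι] [P.IsRootSystem] [P.IsCrystallographic] [P.IsReduced]
  [P.IsIrreducible] {b : P.Base} {γ : b.support}
  {P' : RootPairing ι' ℝ M' N'} [Fintype ι'] [P'.IsRootSystem] [P'.IsCrystallographic]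
  [P'.IsReduced] [P'.IsIrreducible] {b' : P'.Base} {γ' : b'.support}
  [Fact (IsCominuscule b γ)] [Fact (IsCominuscule b' γ')]
  {ν : LowerSet (RootPoset b γ)} {ν' : LowerSet (RootPoset b' γ')}
  {F : RootPoset b γ → RootPoset b' γ'} {G : RootPoset b' γ' → RootPoset b γ}

namespace IsLabeledIso

lemma isEnum_map (h : IsLabeledIso ν ν' F G) {L : List (RootPoset b γ)} (hL : IsEnum ν L) :
    IsEnum ν' (L.map F) := by
  refine ⟨fun y ↦ ?_, ?_⟩
  · rw [List.mem_map]
    constructor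
    · rintro ⟨x, hx, rfl⟩
      exact h.mem x ((hL.1 x).1 hx)
    · intro hy
      exact ⟨G y, (hL.1 _).2 (h.mem' y hy), h.right y hy⟩
  · rw [List.pairwise_map]
    refine hL.2.imp_of_mem fun {x y} hx hy hxy ↦ ?_
    rwa [h.le_iff x ((hL.1 x).1 hx) y ((hL.1 y).1 hy)]

/-- The bijection between supports that sends the label of `x` to the label of `F x`. -/
lemma exists_equiv (h : IsLabeledIso ν ν' F G) : ∃ ψ : supp ν ≃ supp ν',
    ∀ x ∈ ν, ∀ s : supp ν, s.1 = label x → (ψ s).1 = label (F x) := by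
  have hC := h.preservesPairing
  have hC' := h.symm.preservesPairing
  choose c hc hc' using fun s : supp ν ↦ mem_supp_iff.1 s.2
  choose d hd hd' using fun s : supp ν' ↦ mem_supp_iff.1 s.2
  refine ⟨⟨fun s ↦ ⟨label (F (c s)), label_mem_supp (h.mem _ (hc s))⟩,
    fun s ↦ ⟨label (G (d s)), label_mem_supp (h.mem' _ (hd s))⟩, fun s ↦ ?_, fun s ↦ ?_⟩, ?_⟩
  · apply Subtype.ext
    conv_rhs => rw [← hc' s, ← h.left _ (hc s)]
    exact (label_eq_iff hC' (hd _) (h.mem _ (hc s))).2 (hd' _)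
  · apply Subtype.ext
    conv_rhs => rw [← hd' s, ← h.right _ (hd s)]
    exact (label_eq_iff hC (hc _) (h.mem' _ (hd s))).2 (hc' _)
  · intro x hx s hs
    exact (label_eq_iff hC (hc s) hx).2 ((hc' s).trans hs)

lemma pairingIn_equiv (h : IsLabeledIso ν ν' F G) {ψ : supp ν ≃ supp ν'}
    (hψ : ∀ x ∈ ν, ∀ s : supp ν, s.1 = label x → (ψ s).1 = label (F x)) (s t : supp ν) :
    P'.pairingIn ℤ (ψ s).1 (ψ t).1 = P.pairingIn ℤ s.1 t.1 := by
  obtain ⟨x, hx, hxs⟩ := mem_supp_iff.1 s.2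
  obtain ⟨y, hy, hyt⟩ := mem_supp_iff.1 t.2
  rw [hψ x hx s hxs.symm, hψ y hy t hyt.symm, h.preservesPairing x hx y hy, hxs, hyt]

/-- A bijection that preserves the Cartan matrix is an isomorphism of Dynkin diagrams. -/
def diagramIso (h : IsLabeledIso ν ν' F G) {ψ : supp ν ≃ supp ν'}
    (hψ : ∀ x ∈ ν, ∀ s : supp ν, s.1 = label x → (ψ s).1 = label (F x)) :
    Diagram.Iso (subdiagram ν) (subdiagram ν') where
  toEquiv := ψ
  edges_eq s t := by
    have h1 : (ψ s).1 = (ψ t).1 ↔ s.1 = t.1 := by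
      rw [← Subtype.ext_iff, ← Subtype.ext_iff, ψ.apply_eq_iff_eq]
    simp only [subdiagram, Diagram.induce, dynkinDiagram, coxeterWeightIn, h.pairingIn_equiv hψ]
    split_ifs <;> tauto
  arrow_iff s t := by
    have h1 : (ψ s).1 = (ψ t).1 ↔ s.1 = t.1 := by
      rw [← Subtype.ext_iff, ← Subtype.ext_iff, ψ.apply_eq_iff_eq]
    change (dynkinDiagram b').arrow _ _ ↔ (dynkinDiagram b).arrow _ _
    rw [arrow_dynkinDiagram, arrow_dynkinDiagram, h.pairingIn_equiv hψ, h.pairingIn_equiv hψ, Ne,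
      h1]

lemma map_mem_reducedDecompositions (h : IsLabeledIso ν ν' F G) {ψ : supp ν ≃ supp ν'}
    (hψ : ∀ x ∈ ν, ∀ s : supp ν, s.1 = label x → (ψ s).1 = label (F x)) {l : List (supp ν)}
    (hl : l.map Subtype.val ∈ reducedDecompositions b (idealElt ν)) :
    l.map (fun s ↦ (ψ s).1) ∈ reducedDecompositions b' (idealElt ν') := by
  obtain ⟨L, hL, hLl⟩ := mem_reducedDecompositions_iff.1 hl
  refine mem_reducedDecompositions_iff.2 ⟨L.map F, h.isEnum_map hL, ?_⟩
  have key : ∀ (L : List (RootPoset b γ)) (l : List (supp ν)), (∀ x ∈ L, x ∈ ν) →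
      L.map label = l.map Subtype.val → (L.map F).map label = l.map (fun s ↦ (ψ s).1) := by
    intro L
    induction L with
    | nil =>
      intro l _ hl
      rw [List.map_nil, eq_comm, List.map_eq_nil_iff] at hl
      rw [hl]
      rfl
    | cons x L ih =>
      intro l hx hl
      cases l with
      | nil => simp at hl
      | cons s l =>
        simp only [List.map_cons, List.cons.injEq] at hl ⊢
        exact ⟨(hψ x (hx x (by simp)) s hl.1.symm).symm,
          ih l (fun y hy ↦ hx y (by simp [hy])) hl.2⟩
  exact key L l (fun x hx ↦ (hL.1 x).1 hx) hLl

lemma symm_equiv (h : IsLabeledIso ν ν' F G) {ψ : supp ν ≃ supp ν'}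
    (hψ : ∀ x ∈ ν, ∀ s : supp ν, s.1 = label x → (ψ s).1 = label (F x)) :
    ∀ y ∈ ν', ∀ t : supp ν', t.1 = label y → (ψ.symm t).1 = label (G y) := by
  intro y hy t ht
  have h1 := hψ _ (h.mem' y hy) ⟨label (G y), label_mem_supp (h.mem' y hy)⟩ rfl
  rw [h.right y hy, ← ht] at h1
  rw [← Subtype.ext h1, ψ.symm_apply_apply]

lemma map_mem_reducedDecompositions_iff (h : IsLabeledIso ν ν' F G) {ψ : supp ν ≃ supp ν'}
    (hψ : ∀ x ∈ ν, ∀ s : supp ν, s.1 = label x → (ψ s).1 = label (F x)) {l : List (supp ν)} :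
    l.map Subtype.val ∈ reducedDecompositions b (idealElt ν) ↔
      l.map (fun s ↦ (ψ s).1) ∈ reducedDecompositions b' (idealElt ν') := by
  refine ⟨h.map_mem_reducedDecompositions hψ, fun hl ↦ ?_⟩
  have := h.symm.map_mem_reducedDecompositions (h.symm_equiv hψ) (l := l.map ψ) (by
    rw [List.map_map]
    exact hl)
  rw [List.map_map] at this
  convert this using 2
  funext s
  simp

end IsLabeledIso

open Classical in
lemma exists_isLabeledIso (f : ν ≃o ν')
    (hf : ∀ α : ν, IsLong P α.1.idx ↔ IsLong P' (f α).1.idx) :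
    ∃ F G, IsLabeledIso ν ν' F G ∧ ∀ α : ν, F α.1 = (f α).1 := by
  refine ⟨fun x ↦ if h : x ∈ ν then (f ⟨x, h⟩).1 else bottom γ',
    fun y ↦ if h : y ∈ ν' then (f.symm ⟨y, h⟩).1 else bottom γ, ?_, fun α ↦ by simp⟩
  constructor
  · intro x hx
    simp [hx]
  · intro y hy
    simp [hy]
  · intro x hx
    simp [hx]
  · intro y hy
    simp [hy]
  · intro x hx y hy
    simp [hx, hy]
  · intro x hx
    simpa [hx] using hf ⟨x, hx⟩

end DiagramIso

end Cominuscule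

end

theorem mainTheorem2
    {ιX MX NX ιY MY NY : Type*} [Fintype ιX] [Fintype ιY]
    [AddCommGroup MX] [Module ℝ MX] [AddCommGroup NX] [Module ℝ NX]
    [AddCommGroup MY] [Module ℝ MY] [AddCommGroup NY] [Module ℝ NY]
    -- two irreducible reduced crystallographic root systems with cominuscule simple roots
    (RX : RootPairing ιX ℝ MX NX) [RX.IsCrystallographic] [RX.IsReduced] [RX.IsIrreducible]
    (RY : RootPairing ιY ℝ MY NY) [RY.IsCrystallographic] [RY.IsReduced] [RY.IsIrreducible]
    (bX : RX.Base) (γX : bX.support) (hγX : Cominuscule.IsCominuscule bX γX)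
    (bY : RY.Base) (γY : bY.support) (hγY : Cominuscule.IsCominuscule bY γY)
    -- lower order ideals and an isomorphism of labeled posets
    (lam : LowerSet (Cominuscule.RootPoset bX γX)) (mu : LowerSet (Cominuscule.RootPoset bY γY))
    (f : lam ≃o mu)
    (hf : ∀ α : lam, Cominuscule.IsLong RX α.1.idx ↔ Cominuscule.IsLong RY (f α).1.idx) :
    ∃ ψ : Cominuscule.Diagram.Iso (Cominuscule.subdiagram lam) (Cominuscule.subdiagram mu),
      -- `ψ` is induced by `f`
      (∀ α : lam, ∃ s : Cominuscule.supp lam,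
        (s : ιX) = Cominuscule.delta α.1 ∧ (ψ.toEquiv s : ιY) = Cominuscule.delta (f α).1) ∧
      -- reduced decompositions are words in the vertices of the subdiagrams
      (∀ l ∈ Cominuscule.reducedDecompositions bX (Cominuscule.idealElt lam),
        ∀ s ∈ l, s ∈ Cominuscule.supp lam) ∧
      (∀ l ∈ Cominuscule.reducedDecompositions bY (Cominuscule.idealElt mu),
        ∀ s ∈ l, s ∈ Cominuscule.supp mu) ∧
      -- and `ψ` identifies those of `w_λ` with those of `w_μ`
      (∀ l : List (Cominuscule.supp lam),
        l.map Subtype.val ∈ Cominuscule.reducedDecompositions bX (Cominuscule.idealElt lam) ↔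
          l.map (fun s ↦ (ψ.toEquiv s).val) ∈
            Cominuscule.reducedDecompositions bY (Cominuscule.idealElt mu)) := by
  have : Nonempty ιX := ⟨γX⟩
  have : Nonempty ιY := ⟨γY⟩
  have := Fact.mk hγX
  have := Fact.mk hγY
  obtain ⟨F, G, h, hF⟩ := Cominuscule.exists_isLabeledIso f hf
  obtain ⟨ψ, hψ⟩ := h.exists_equiv
  refine ⟨h.diagramIso hψ, fun α ↦ ⟨⟨_, Cominuscule.label_mem_supp α.2⟩, ?_, ?_⟩,
    fun l hl s hs ↦ Cominuscule.mem_supp_of_mem hl hs,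
    fun l hl s hs ↦ Cominuscule.mem_supp_of_mem hl hs,
    fun l ↦ h.map_mem_reducedDecompositions_iff hψ⟩
  · rw [Cominuscule.delta_eq_label]
  · rw [Cominuscule.delta_eq_label, ← hF α]
    exact congrArg Subtype.val (hψ α.1 α.2 _ rfl)
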